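/- Let $n\in\mathbb N$ and let $\{1,\dots,n\}=P_1\sqcup P_2$ be a partition of the index set. For a kernel $\kappa\in L^2(\mathbb R^{2n})$ let $\widehat\kappa$ be the integral operator $(\widehat\kappa f)(x)=\int_{\mathbb R^n}\kappa(x,y)f(y)\,\mathrm dy$ on the complex Hilbert space $L^2(\mathbb R^n)$. It is called a density operator if it is positive semidefinite (and hence self-adjoint) and trace-class with trace $1$, that is, its eigenvalues, counted with multiplicity, are non-negative and sum to $1$. Writing $x=(x^{(1)},x^{(2)})$ and $y=(y^{(1)},y^{(2)})$ according to the partition, the partial transpose of a kernel $\rho$ is $$\widetilde\rho\big(x^{(1)},x^{(2)};\,y^{(1)},y^{(2)}\big)=\rho\big(y^{(1)},x^{(2)};\,x^{(1)},y^{(2)}\big).$$ A density operator $\widehat\rho$ is called PPT if $\widetilde\rho$ is the kernel of a density operator, and NPT otherwise. Let $A,B,C\in\mathbb R^{n\times n}$ with $A,C$ symmetric positive definite and $B$ arbitrary, and let $c_0>0$ be such that $$\rho_G(x,y)=c_0\exp\left\{-(x-y)^{\top}A(x-y)-i(x-y)^{\top}B(x+y)-(x+y)^{\top}C(x+y)\right\}$$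 is the kernel of a density operator $\widehat\rho_G$ (a Gaussian density operator). Let $P\colon\mathbb R^{2n}\to\mathbb C$ be a polynomial which is self-adjoint, i.e. $P(y,x)=\overline{P(x,y)}$ for all $x,y\in\mathbb R^n$. Assume that $P\rho_G$ is the kernel of a positive semidefinite operator and that some constant multiple $\rho_{PG}=c\,P\rho_G$ is the kernel of a density operator $\widehat\rho_{PG}$ (the polynomial Gaussian density operator). If $\widehat\rho_G$ is NPT, then $\widehat\rho_{PG}$ is NPT as well. -/

import Mathlib

open MeasureTheory
open scoped Matrix

namespace PolynomialGaussian

noncomputable section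

/-- The Hilbert space `L²(ℝⁿ)` of complex-valued square integrable functions. -/
abbrev L2 (n : ℕ) : Type :=
  Lp ℂ 2 (volume : Measure (Fin n → ℝ))

/-- The bounded operator `T` on `L²(ℝⁿ)` is the integral operator with the square integrable
kernel `κ ∈ L²(ℝ²ⁿ)`, that is, `(T f)(x) = ∫ κ(x, y) f(y) dy` for every `f ∈ L²(ℝⁿ)` and almost
every `x`. -/
def IsIntegralOperator {n : ℕ} (κ : (Fin n → ℝ) → (Fin n → ℝ) → ℂ) (T : L2 n →L[ℂ] L2 n) : Prop :=
  MemLp (fun z : (Fin n → ℝ) × (Fin n → ℝ) => κ z.1 z.2) 2 volume ∧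
    ∀ f : L2 n, ∀ᵐ x : Fin n → ℝ, T f x = ∫ y : Fin n → ℝ, κ x y * f y

/-- The operator `T` is diagonalized by an orthonormal basis of eigenvectors with real eigenvalues,
counted with multiplicity, that are absolutely summable with sum `t` (for families of reals,
`HasSum` is unconditional, hence absolute, summability). For a compact self-adjoint `T` this says
that `T` is trace-class with trace `t`. -/
def HasTrace {n : ℕ} (T : L2 n →L[ℂ] L2 n) (t : ℝ) : Prop :=
  ∃ (ι : Type) (b : HilbertBasis ι ℂ (L2 n)) (l : ι → ℝ),
    (∀ i, T (b i) = (l i : ℂ) • b i) ∧ HasSum l t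

/-- A density operator: positive semidefinite with trace one. -/
def IsDensityOperator {n : ℕ} (T : L2 n →L[ℂ] L2 n) : Prop :=
  T.IsPositive ∧ HasTrace T 1

/-- `κ` is the kernel of a positive semidefinite operator. -/
def IsPositiveKernel {n : ℕ} (κ : (Fin n → ℝ) → (Fin n → ℝ) → ℂ) : Prop :=
  ∃ T : L2 n →L[ℂ] L2 n, IsIntegralOperator κ T ∧ T.IsPositive

/-- `κ` is the kernel of a density operator. -/
def IsDensityKernel {n : ℕ} (κ : (Fin n → ℝ) → (Fin n → ℝ) → ℂ) : Prop :=
  ∃ T : L2 n →L[ℂ] L2 n, IsIntegralOperator κ T ∧ IsDensityOperator T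

/-- The Gaussian kernel
`exp(-(x-y)ᵀ A (x-y) - i (x-y)ᵀ B (x+y) - (x+y)ᵀ C (x+y))`. -/
def gaussianKernel {n : ℕ} (A B C : Matrix (Fin n) (Fin n) ℝ) (x y : Fin n → ℝ) : ℂ :=
  Complex.exp
    (-(((x - y) ⬝ᵥ A *ᵥ (x - y) : ℝ) : ℂ)
      - Complex.I * (((x - y) ⬝ᵥ B *ᵥ (x + y) : ℝ) : ℂ)
      - (((x + y) ⬝ᵥ C *ᵥ (x + y) : ℝ) : ℂ))

/-- `ρ` is the kernel of a Gaussian density operator: a positive multiple of a Gaussian kernel, with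
`A` and `C` symmetric positive definite and `B` arbitrary, that defines a density operator. -/
def IsGaussianDensityKernel {n : ℕ} (ρ : (Fin n → ℝ) → (Fin n → ℝ) → ℂ) : Prop :=
  (∃ (c : ℝ) (A B C : Matrix (Fin n) (Fin n) ℝ), 0 < c ∧ A.PosDef ∧ C.PosDef ∧
    ∀ x y, ρ x y = (c : ℂ) * gaussianKernel A B C x y) ∧
  IsDensityKernel ρ

/-- The value `P(x, y)` of a complex polynomial in `2n` variables; the variables `Sum.inl i` stand
for the `x i`, the variables `Sum.inr i` for the `y i`. -/
def polyVal {n : ℕ} (P : MvPolynomial (Fin n ⊕ Fin n) ℂ) (x y : Fin n → ℝ) : ℂ :=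
  MvPolynomial.eval (Sum.elim (fun i => (x i : ℂ)) (fun i => (y i : ℂ))) P

/-- `P` is self-adjoint: `P(y, x)` is the complex conjugate of `P(x, y)` for all real `x, y`. -/
def IsSelfAdjointPolynomial {n : ℕ} (P : MvPolynomial (Fin n ⊕ Fin n) ℂ) : Prop :=
  ∀ x y : Fin n → ℝ, polyVal P y x = (starRingEnd ℂ) (polyVal P x y)

/-- `ρPG` is the kernel of the polynomial Gaussian density operator with polynomial factor `P` and
Gaussian factor `ρG`: the product `P ρG` is the kernel of a positive semidefinite operator, and
`ρPG` is the constant multiple of it that defines a density operator. -/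
def IsPolynomialGaussianDensityKernel {n : ℕ} (P : MvPolynomial (Fin n ⊕ Fin n) ℂ)
    (ρG ρPG : (Fin n → ℝ) → (Fin n → ℝ) → ℂ) : Prop :=
  IsPositiveKernel (fun x y => polyVal P x y * ρG x y) ∧
  (∃ c : ℂ, ∀ x y, ρPG x y = c * (polyVal P x y * ρG x y)) ∧
  IsDensityKernel ρPG

/-- The partial transpose of a kernel in the coordinates belonging to `S`: for `i ∈ S` the
coordinates `x i` and `y i` are interchanged. -/
def partialTranspose {n : ℕ} (S : Finset (Fin n)) (κ : (Fin n → ℝ) → (Fin n → ℝ) → ℂ)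
    (x y : Fin n → ℝ) : ℂ :=
  κ (fun i => if i ∈ S then y i else x i) (fun i => if i ∈ S then x i else y i)

/-- A density operator, given by its kernel `ρ`, is PPT with respect to the partition `{S, Sᶜ}` of
the index set: the partial transpose of `ρ` is the kernel of a density operator. -/
def IsPPT {n : ℕ} (S : Finset (Fin n)) (ρ : (Fin n → ℝ) → (Fin n → ℝ) → ℂ) : Prop :=
  IsDensityKernel ρ ∧ IsDensityKernel (partialTranspose S ρ)

/-- A density operator, given by its kernel `ρ`, is NPT if it is not PPT. -/
def IsNPT {n : ℕ} (S : Finset (Fin n)) (ρ : (Fin n → ℝ) → (Fin n → ℝ) → ℂ) : Prop :=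
  IsDensityKernel ρ ∧ ¬ IsPPT S ρ

end

end PolynomialGaussian

open PolynomialGaussian

/-!
Partial transposition in the coordinates of `S` keeps `x + y` and changes signs of coordinates of
`x - y`. Hence it maps a Gaussian kernel `G` to a Gaussian kernel of the same form, and a polynomial
multiple `p G` to a polynomial multiple of the transposed Gaussian. It also keeps the diagonal. So
the claim follows from two facts about a Gaussian kernel `G`:

* if `p G` is the kernel of a positive operator for some polynomial `p ≠ 0`, then `G` is the kernel
  of a positive operator (`isPositive_of_isPositive_polynomial_mul`);
* a positive integral operator with continuous kernel `κ` has trace `∫ κ x x dx`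
  (`lintegral_diagonal_eq`, `hasTrace_of_lintegral_diagonal_eq`).

For the first fact, let `a ∈ ℂⁿ`. Translating `G` by `(conj a, a)` multiplies it by a positive
constant and by a product `conj (h x) * h y` with `h` the exponential of a linear form
(`gaussianExponent_add_conjPair`). Test the operator on `y ↦ g (y - a) / h (y - a)`, where `g` is
entire and decays faster than every exponential, and move the domain of integration into the complex
domain (`RapidOnTubes.integral_add_eq`). The result is that the kernel
`p (x + conj a, y + a) G (x, y)` is nonnegative on `g` (`integral_translate_nonneg`). Replacing `a`
by `t a` and dividing by the power of `t` that belongs to the degree of `p`, one gets in the limit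
`t → ∞` that `P (conj a, a) G` is nonnegative on `g`, with `P` the leading form of `p`
(`leadingForm_mul_integral_nonneg`). The vectors `(conj a, a)` form a totally real subspace of full
dimension, so `P (conj a, a) ≠ 0` for some `a`. The functions `g` are dense in `L²`
(`dense_rapidSubmodule`), and testing against approximations of the delta function at `0` shows that
`P (conj a, a)` is positive. Hence `G` is positive.

For the second fact, a Hilbert–Schmidt operator is compact, hence diagonalizable if it is symmetric.
Let `d` be the normalized indicator function of a small ball around `x`. Then `⟪d, T d⟫` tends to
`κ x x` as the ball shrinks, and it equals the sum of the `l i * ‖⟪d, b i⟫‖ ^ 2` over the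
eigenvectors `b i` with eigenvalues `l i`. One inequality follows from Lebesgue differentiation, the
other from Fatou's lemma and the fact that averaging over balls is a contraction of `L²`.
-/

namespace PolynomialGaussian

open Filter Topology Metric
open scoped ENNReal ComplexConjugate InnerProductSpace ComplexOrder

/-! ### Integral operators with square integrable kernels -/

/-- Almost every section of a square integrable kernel is square integrable. -/
theorem memLp_section {n : ℕ} {κ : (Fin n → ℝ) → (Fin n → ℝ) → ℂ}
    (hκ : MemLp (fun z : (Fin n → ℝ) × (Fin n → ℝ) => κ z.1 z.2) 2 volume) :
    ∀ᵐ x : Fin n → ℝ, MemLp (κ x) 2 volume := by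
  have h1 : Integrable (fun z : (Fin n → ℝ) × (Fin n → ℝ) => ‖κ z.1 z.2‖ ^ 2)
      (volume.prod volume) := (memLp_two_iff_integrable_sq_norm hκ.1).1 hκ
  have h2 : AEStronglyMeasurable (fun z : (Fin n → ℝ) × (Fin n → ℝ) => κ z.1 z.2)
      (volume.prod volume) := hκ.1
  filter_upwards [h1.prod_right_ae, h2.prodMk_left] with x hx hx'
  exact (memLp_two_iff_integrable_sq_norm hx').2 hx

theorem norm_sq_eq_integral {n : ℕ} (f : L2 n) : ‖f‖ ^ 2 = ∫ x, ‖f x‖ ^ 2 := by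
  have h := @norm_sq_eq_re_inner ℂ _ _ _ _ f
  rw [L2.inner_def] at h
  rw [h]
  have : ∀ x, ⟪f x, f x⟫_ℂ = ((‖f x‖ ^ 2 : ℝ) : ℂ) := fun x => by
    rw [inner_self_eq_norm_sq_to_K]; push_cast; rfl
  simp_rw [this]
  rw [integral_complex_ofReal]
  exact Complex.ofReal_re _

theorem norm_toLp_sq {n : ℕ} {f : (Fin n → ℝ) → ℂ} (hf : MemLp f 2 volume) :
    ‖hf.toLp f‖ ^ 2 = ∫ x, ‖f x‖ ^ 2 := by
  rw [norm_sq_eq_integral]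
  refine integral_congr_ae ?_
  filter_upwards [hf.coeFn_toLp] with x hx
  rw [hx]

theorem integral_section_eq_inner {n : ℕ} {k : (Fin n → ℝ) → ℂ} (hk : MemLp k 2 volume)
    (f : L2 n) : ∫ y, k y * f y = ⟪hk.star.toLp (star k), f⟫_ℂ := by
  rw [L2.inner_def]
  refine integral_congr_ae ?_
  filter_upwards [hk.star.coeFn_toLp] with y hy
  rw [hy]
  simp [mul_comm]

theorem norm_toLp_star_sq {n : ℕ} {k : (Fin n → ℝ) → ℂ} (hk : MemLp k 2 volume) :
    ‖hk.star.toLp (star k)‖ ^ 2 = ∫ y, ‖k y‖ ^ 2 := by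
  rw [norm_toLp_sq]; simp

theorem norm_sq_integral_section_le {n : ℕ} {k : (Fin n → ℝ) → ℂ} (hk : MemLp k 2 volume)
    (f : L2 n) : ‖∫ y, k y * f y‖ ^ 2 ≤ (∫ y, ‖k y‖ ^ 2) * ‖f‖ ^ 2 := by
  rw [integral_section_eq_inner hk, ← norm_toLp_star_sq hk, ← mul_pow]
  gcongr
  exact norm_inner_le_norm _ _

section

variable {n : ℕ} {κ : (Fin n → ℝ) → (Fin n → ℝ) → ℂ}

theorem integrable_sq_norm_kernel
    (hκ : MemLp (fun z : (Fin n → ℝ) × (Fin n → ℝ) => κ z.1 z.2) 2 volume) :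
    Integrable (fun x => ∫ y, ‖κ x y‖ ^ 2) :=
  Integrable.integral_prod_left
    (f := fun z : (Fin n → ℝ) × (Fin n → ℝ) => ‖κ z.1 z.2‖ ^ 2)
    ((memLp_two_iff_integrable_sq_norm hκ.1).1 hκ)

theorem aestronglyMeasurable_integral_kernel
    (hκ : MemLp (fun z : (Fin n → ℝ) × (Fin n → ℝ) => κ z.1 z.2) 2 volume) (f : L2 n) :
    AEStronglyMeasurable (fun x => ∫ y, κ x y * f y) volume := by
  have h2 : AEStronglyMeasurable (fun z : (Fin n → ℝ) × (Fin n → ℝ) => κ z.1 z.2)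
      (volume.prod volume) := hκ.1
  exact (h2.mul ((Lp.aestronglyMeasurable f).comp_snd)).integral_prod_right'

theorem memLp_integral_kernel
    (hκ : MemLp (fun z : (Fin n → ℝ) × (Fin n → ℝ) => κ z.1 z.2) 2 volume) (f : L2 n) :
    MemLp (fun x => ∫ y, κ x y * f y) 2 volume := by
  have hm := aestronglyMeasurable_integral_kernel hκ f
  rw [memLp_two_iff_integrable_sq_norm hm]
  refine ((integrable_sq_norm_kernel hκ).mul_const (‖f‖ ^ 2)).mono' (hm.norm.pow 2) ?_
  filter_upwards [memLp_section hκ] with x hx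
  rw [Real.norm_of_nonneg (by positivity)]
  exact norm_sq_integral_section_le hx f

theorem integrable_section_mul {k : (Fin n → ℝ) → ℂ} (hk : MemLp k 2 volume) (f : L2 n) :
    Integrable (fun y => k y * f y) :=
  hk.integrable_mul (Lp.memLp f)

/-- Every square integrable kernel defines a bounded integral operator. -/
theorem exists_isIntegralOperator
    (hκ : MemLp (fun z : (Fin n → ℝ) × (Fin n → ℝ) => κ z.1 z.2) 2 volume) :
    ∃ T : L2 n →L[ℂ] L2 n, IsIntegralOperator κ T := by
  let T₀ : L2 n →ₗ[ℂ] L2 n :=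
    { toFun := fun f => (memLp_integral_kernel hκ f).toLp _
      map_add' := fun f g => by
        rw [← MemLp.toLp_add, MemLp.toLp_eq_toLp_iff]
        filter_upwards [memLp_section hκ] with x hx
        rw [Pi.add_apply, ← integral_add (integrable_section_mul hx f)
          (integrable_section_mul hx g)]
        refine integral_congr_ae ?_
        filter_upwards [Lp.coeFn_add f g] with y hy
        rw [hy, Pi.add_apply, mul_add]
      map_smul' := fun c f => by
        rw [RingHom.id_apply, ← MemLp.toLp_const_smul, MemLp.toLp_eq_toLp_iff]
        refine ae_of_all _ fun x => ?_
        rw [Pi.smul_apply, ← integral_smul]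
        refine integral_congr_ae ?_
        filter_upwards [Lp.coeFn_smul c f] with y hy
        rw [hy, Pi.smul_apply, smul_eq_mul, smul_eq_mul]
        ring }
  refine ⟨T₀.mkContinuous (√(∫ x, ∫ y, ‖κ x y‖ ^ 2)) fun f => ?_, hκ, fun f => ?_⟩
  · have h0 : 0 ≤ ∫ x, ∫ y, ‖κ x y‖ ^ 2 :=
      integral_nonneg fun x => integral_nonneg fun y => by positivity
    refine le_of_sq_le_sq ?_ (by positivity)
    rw [mul_pow, Real.sq_sqrt h0, ← integral_mul_const]
    change ‖(memLp_integral_kernel hκ f).toLp _‖ ^ 2 ≤ _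
    rw [norm_toLp_sq]
    refine integral_mono_ae
      ((memLp_two_iff_integrable_sq_norm (memLp_integral_kernel hκ f).1).1
        (memLp_integral_kernel hκ f))
      ((integrable_sq_norm_kernel hκ).mul_const _) ?_
    filter_upwards [memLp_section hκ] with x hx
    exact norm_sq_integral_section_le hx f
  · exact (memLp_integral_kernel hκ f).coeFn_toLp

theorem integrable_tensor {f g : (Fin n → ℝ) → ℂ} (hf : MemLp f 2 volume)
    (hg : MemLp g 2 volume)
    (hκ : MemLp (fun z : (Fin n → ℝ) × (Fin n → ℝ) => κ z.1 z.2) 2 volume) :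
    Integrable (fun z : (Fin n → ℝ) × (Fin n → ℝ) => conj (f z.1) * (κ z.1 z.2 * g z.2)) := by
  have h1 : MemLp (fun z : (Fin n → ℝ) × (Fin n → ℝ) => conj (f z.1) * g z.2) 2
      (volume.prod volume) := by
    have hm : AEStronglyMeasurable (fun z : (Fin n → ℝ) × (Fin n → ℝ) => conj (f z.1) * g z.2)
      (volume.prod volume) := (hf.star.1.comp_fst).mul hg.1.comp_snd
    rw [memLp_two_iff_integrable_sq_norm hm]
    have := ((memLp_two_iff_integrable_sq_norm hf.1).1 hf).mul_prod
      ((memLp_two_iff_integrable_sq_norm hg.1).1 hg)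
    simpa [mul_pow] using this
  have := MemLp.integrable_mul h1 hκ
  refine this.congr (ae_of_all _ fun z => ?_)
  simp only [Pi.mul_apply]
  ring

/-- The quadratic form of an integral operator as a double integral. -/
theorem IsIntegralOperator.inner_apply {T : L2 n →L[ℂ] L2 n} (hT : IsIntegralOperator κ T)
    {f g : (Fin n → ℝ) → ℂ} (hf : MemLp f 2 volume) (hg : MemLp g 2 volume) :
    ⟪hf.toLp f, T (hg.toLp g)⟫_ℂ =
      ∫ z : (Fin n → ℝ) × (Fin n → ℝ), conj (f z.1) * (κ z.1 z.2 * g z.2) := by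
  have h := integrable_tensor hf hg hT.1
  rw [Measure.volume_eq_prod] at h ⊢
  rw [integral_prod _ h, L2.inner_def]
  refine integral_congr_ae ?_
  filter_upwards [hf.coeFn_toLp, hT.2 (hg.toLp g)] with x hx hx'
  rw [hx, hx', integral_const_mul, RCLike.inner_apply, mul_comm]
  congr 1
  refine integral_congr_ae ?_
  filter_upwards [hg.coeFn_toLp] with y hy
  rw [hy]

/-- Integral operators with square integrable kernels are Hilbert–Schmidt: by Bessel's inequality
for the sections of the kernel, the squared norms of the images of an orthonormal family have
bounded sums. -/
theorem IsIntegralOperator.sum_norm_sq_le {T : L2 n →L[ℂ] L2 n} (hT : IsIntegralOperator κ T)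
    {ι : Type*} {b : ι → L2 n} (hb : Orthonormal ℂ b) (F : Finset ι) :
    ∑ i ∈ F, ‖T (b i)‖ ^ 2 ≤ ∫ x, ∫ y, ‖κ x y‖ ^ 2 := by
  have hi : ∀ i ∈ F, Integrable (fun x => ‖T (b i) x‖ ^ 2) := fun i _ =>
    (memLp_two_iff_integrable_sq_norm (Lp.aestronglyMeasurable _)).1 (Lp.memLp (T (b i)))
  simp_rw [norm_sq_eq_integral]
  rw [← integral_finsetSum _ hi]
  refine integral_mono_ae (integrable_finsetSum _ hi) (integrable_sq_norm_kernel hT.1) ?_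
  have hF : ∀ᵐ x : Fin n → ℝ, ∀ i ∈ F, T (b i) x = ∫ y, κ x y * b i y :=
    (ae_ball_iff F.countable_toSet).2 fun i _ => hT.2 (b i)
  filter_upwards [memLp_section hT.1, hF] with x hx hx'
  rw [← norm_toLp_star_sq hx]
  refine le_trans (le_of_eq ?_) (hb.sum_inner_products_le (s := F) (hx.star.toLp (star (κ x))))
  refine Finset.sum_congr rfl fun i hi => ?_
  rw [hx' i hi, integral_section_eq_inner hx, norm_inner_symm]

end

section

variable {H : Type*} [NormedAddCommGroup H] [InnerProductSpace ℂ H] [CompleteSpace H]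

/-- A Hilbert–Schmidt operator is compact: it is the norm limit of its restrictions to finitely
many basis vectors. -/
theorem isCompactOperator_of_sum_norm_sq_le {ι : Type*} (b : HilbertBasis ι ℂ H)
    (T : H →L[ℂ] H) {C : ℝ} (hC : ∀ F : Finset ι, ∑ i ∈ F, ‖T (b i)‖ ^ 2 ≤ C) :
    IsCompactOperator T := by
  have hs : Summable fun i => ‖T (b i)‖ ^ 2 :=
    summable_of_sum_le (fun i => by positivity) hC
  -- `R F` is the composition of `T` with the orthogonal projection to the span of `b i`, `i ∈ F`.
  let R : Finset ι → H →L[ℂ] H := fun F =>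
    ∑ i ∈ F, (innerSL ℂ (b i)).smulRight (T (b i))
  have hR : ∀ F x, R F x = ∑ i ∈ F, ⟪b i, x⟫_ℂ • T (b i) := fun F x => by
    simp [R]
  have hRc : ∀ F, IsCompactOperator (R F) := by
    intro F
    have h1 : ∀ i, IsCompactOperator ((innerSL ℂ (b i)).smulRight (T (b i))) := by
      intro i
      have h2 : IsCompactOperator (_root_.id : ℂ → ℂ) :=
        (isCompactOperator_id_iff_finiteDimensional (𝕜 := ℂ)).2 inferInstance
      exact (h2.comp_clm (innerSL ℂ (b i))).clm_comp
        ((ContinuousLinearMap.id ℂ ℂ).smulRight (T (b i)))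
    exact Submodule.sum_mem (compactOperator (RingHom.id ℂ) H H) fun i _ => h1 i
  refine isCompactOperator_of_tendsto (l := atTop) (F := R) ?_ (Eventually.of_forall hRc)
  classical
  rw [Metric.tendsto_atTop]
  intro ε hε
  obtain ⟨F, hF⟩ := summable_iff_vanishing_norm.1 hs ((ε / 2) ^ 2) (by positivity)
  refine ⟨F, fun G hG => ?_⟩
  rw [dist_comm, dist_eq_norm]
  refine lt_of_le_of_lt (ContinuousLinearMap.opNorm_le_bound _ (by positivity : 0 ≤ ε / 2)
    fun x => ?_) (half_lt_self hε)
  have hsum : HasSum (fun i => ⟪b i, x⟫_ℂ • T (b i)) (T x) := by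
    have := (b.hasSum_repr x).mapL T
    simpa [b.repr_apply_apply] using this
  have hlim : Tendsto (fun K : Finset ι => ‖∑ i ∈ K, ⟪b i, x⟫_ℂ • T (b i) - R G x‖) atTop
      (𝓝 ‖T x - R G x‖) := (Tendsto.sub_const hsum _).norm
  rw [sub_apply]
  refine le_of_tendsto hlim ?_
  filter_upwards [eventually_ge_atTop G] with K hK
  rw [hR, ← Finset.sum_sdiff hK, add_sub_cancel_right]
  have hd : ∑ i ∈ K \ G, ‖T (b i)‖ ^ 2 ≤ (ε / 2) ^ 2 := by
    have := hF (K \ G) (Finset.disjoint_of_subset_right hG Finset.sdiff_disjoint)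
    exact (le_abs_self _).trans this.le
  have hx := b.orthonormal.sum_inner_products_le (s := K \ G) x
  refine (norm_sum_le _ _).trans ?_
  simp_rw [norm_smul]
  refine le_of_sq_le_sq ?_ (by positivity)
  refine (Finset.sum_mul_sq_le_sq_mul_sq _ _ _).trans ?_
  rw [mul_pow, mul_comm]
  gcongr

end

universe u

/-- A compact symmetric operator has an orthonormal basis of eigenvectors with real eigenvalues. -/
theorem exists_eigenbasis {H : Type u} [NormedAddCommGroup H] [InnerProductSpace ℂ H]
    [CompleteSpace H] {T : H →L[ℂ] H} (hc : IsCompactOperator T) (hs : T.IsSymmetric) :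
    ∃ (ι : Type u) (b : HilbertBasis ι ℂ H) (l : ι → ℝ), ∀ i, T (b i) = (l i : ℂ) • b i := by
  let V : ℂ → Submodule ℂ H := fun μ => Module.End.eigenspace (T : Module.End ℂ H) μ
  have hV : OrthogonalFamily ℂ (fun μ => V μ) fun μ => (V μ).subtypeₗᵢ :=
    LinearMap.IsSymmetric.orthogonalFamily_eigenspaces hs
  have hmemV : ∀ μ x, x ∈ V μ ↔ T x = μ • x := fun μ x => Module.End.mem_eigenspace_iff
  have hcomp : ∀ μ : ℂ, CompleteSpace (V μ) := by
    intro μ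
    have : IsClosed (V μ : Set H) := by
      have h1 : (V μ : Set H) = {x | T x = μ • x} := by
        ext x
        exact hmemV μ x
      rw [h1]
      exact isClosed_eq T.continuous (continuous_const_smul μ)
    exact this.completeSpace_coe
  choose w e he using fun μ : ℂ => exists_hilbertBasis ℂ (V μ)
  let v : (Σ μ : ℂ, w μ) → H := fun a => (e a.1 a.2 : H)
  have ho : Orthonormal ℂ v := hV.orthonormal_sigma_orthonormal (v_family := fun μ => e μ)
    fun μ => (e μ).orthonormal
  have hle : (⨆ μ, V μ) ≤ (Submodule.span ℂ (Set.range v)).topologicalClosure := by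
    refine iSup_le fun μ x hx => ?_
    have h2 := ((e μ).hasSum_repr ⟨x, hx⟩).mapL (Submodule.subtypeL (V μ))
    refine mem_closure_of_tendsto h2 (Eventually.of_forall fun F => ?_)
    refine Submodule.sum_mem _ fun i _ => ?_
    rw [map_smul]
    exact Submodule.smul_mem _ _ (Submodule.subset_span ⟨⟨μ, i⟩, rfl⟩)
  have hbot : (Submodule.span ℂ (Set.range v))ᗮ = ⊥ := by
    rw [eq_bot_iff, ← ContinuousLinearMap.orthogonalComplement_iSup_eigenspaces_eq_bot hc hs,
      ← Submodule.orthogonal_closure (Submodule.span ℂ _)]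
    exact Submodule.orthogonal_le hle
  refine ⟨Σ μ : ℂ, w μ, HilbertBasis.mkOfOrthogonalEqBot ho hbot, fun a => a.1.re, fun a => ?_⟩
  rw [HilbertBasis.coe_mkOfOrthogonalEqBot]
  have hmem : v a ∈ V a.1 := (e a.1 a.2).2
  have hreal : conj a.1 = a.1 := hs.conj_eigenvalue_eq_self
    (Module.End.hasEigenvalue_of_hasEigenvector ⟨hmem, ho.ne_zero a⟩)
  rw [Complex.conj_eq_iff_re.1 hreal]
  exact (hmemV _ _).1 hmem

/-! ### The trace of a positive integral operator with continuous kernel -/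

theorem volume_closedBall_ne_top {n : ℕ} (x : Fin n → ℝ) (r : ℝ) :
    volume (closedBall x r) ≠ ∞ := measure_closedBall_lt_top.ne

theorem volume_closedBall_ne_zero {n : ℕ} (x : Fin n → ℝ) {r : ℝ} (hr : 0 < r) :
    volume (closedBall x r) ≠ 0 := (measure_closedBall_pos _ _ hr).ne'

/-- The normalized indicator function of the closed ball of radius `r` around `x`. -/
noncomputable def ballDensity {n : ℕ} (x : Fin n → ℝ) (r : ℝ) : (Fin n → ℝ) → ℂ :=
  (closedBall x r).indicator fun _ => ((volume.real (closedBall x r))⁻¹ : ℂ)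

theorem memLp_ballDensity {n : ℕ} (x : Fin n → ℝ) (r : ℝ) :
    MemLp (ballDensity x r) 2 volume :=
  memLp_indicator_const 2 measurableSet_closedBall _ (Or.inr (volume_closedBall_ne_top x r))

theorem conj_ballDensity {n : ℕ} (x : Fin n → ℝ) (r : ℝ) (y : Fin n → ℝ) :
    conj (ballDensity x r y) = ballDensity x r y := by
  unfold ballDensity
  by_cases h : y ∈ closedBall x r <;> simp [h]

theorem inner_ballDensity {n : ℕ} (x : Fin n → ℝ) (r : ℝ) (f : L2 n) :
    ⟪(memLp_ballDensity x r).toLp _, f⟫_ℂ = ⨍ y in closedBall x r, f y := by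
  rw [L2.inner_def, setAverage_eq, ← integral_indicator measurableSet_closedBall,
    ← integral_smul]
  refine integral_congr_ae ?_
  filter_upwards [(memLp_ballDensity x r).coeFn_toLp] with y hy
  rw [hy, RCLike.inner_apply, conj_ballDensity, ballDensity]
  by_cases h : y ∈ closedBall x r <;> simp [h, mul_comm]

/-- The quadratic form of an integral operator with continuous kernel at an approximation of the
delta function at `x` tends to the value of the kernel at `(x, x)`. -/
theorem tendsto_inner_ballDensity {n : ℕ} {κ : (Fin n → ℝ) → (Fin n → ℝ) → ℂ}
    {T : L2 n →L[ℂ] L2 n} (hT : IsIntegralOperator κ T)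
    (hc : Continuous fun z : (Fin n → ℝ) × (Fin n → ℝ) => κ z.1 z.2) (x : Fin n → ℝ) :
    Tendsto (fun r => ⟪(memLp_ballDensity x r).toLp _, T ((memLp_ballDensity x r).toLp _)⟫_ℂ)
      (𝓝[>] 0) (𝓝 (κ x x)) := by
  have key : ∀ r, ⟪(memLp_ballDensity x r).toLp _, T ((memLp_ballDensity x r).toLp _)⟫_ℂ =
      ⨍ z in closedBall (x, x) r, κ z.1 z.2 := by
    intro r
    rw [hT.inner_apply, setAverage_eq, ← closedBall_prod_same,
      ← integral_indicator (measurableSet_closedBall.prod measurableSet_closedBall),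
      ← integral_smul]
    refine integral_congr_ae (ae_of_all _ fun z => ?_)
    simp only [conj_ballDensity]
    simp only [ballDensity]
    have hv : (volume : Measure ((Fin n → ℝ) × (Fin n → ℝ))).real
        (closedBall x r ×ˢ closedBall x r) =
        volume.real (closedBall x r) * volume.real (closedBall x r) := by
      rw [Measure.volume_eq_prod, measureReal_prod_prod]
    rw [hv]
    by_cases h1 : z.1 ∈ closedBall x r <;> by_cases h2 : z.2 ∈ closedBall x r
    · rw [Set.indicator_of_mem h1, Set.indicator_of_mem h2,
        Set.indicator_of_mem (Set.mem_prod.2 ⟨h1, h2⟩), Complex.real_smul]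
      push_cast
      rw [mul_inv]
      ring
    all_goals simp [h1, h2]
  simp_rw [key]
  rw [Metric.tendsto_nhds]
  intro ε hε
  obtain ⟨δ, hδ, h⟩ := Metric.continuous_iff.1 hc (x, x) (ε / 2) (by positivity)
  filter_upwards [Ioo_mem_nhdsGT hδ] with r hr
  refine lt_of_le_of_lt ?_ (half_lt_self hε)
  have h0 : volume (closedBall (x, x) r) ≠ 0 := (measure_closedBall_pos _ _ hr.1).ne'
  have hfin : volume (closedBall (x, x) r) ≠ ∞ := measure_closedBall_lt_top.ne
  refine (convex_closedBall (κ x x) (ε / 2)).set_average_mem isClosed_closedBall h0 hfin ?_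
    (hc.locallyIntegrable.integrableOn_isCompact (isCompact_closedBall _ _))
  refine (ae_restrict_iff' measurableSet_closedBall).2 (ae_of_all _ fun z hz => ?_)
  exact (h z (lt_of_le_of_lt hz hr.2)).le

/-- Jensen's inequality for averages over balls. -/
theorem enorm_setAverage_sq_le {n : ℕ} (f : L2 n) (x : Fin n → ℝ) {r : ℝ} (hr : 0 < r) :
    ‖⨍ y in closedBall x r, f y‖ₑ ^ 2 ≤
      (volume (closedBall x r))⁻¹ * ∫⁻ y in closedBall x r, ‖f y‖ₑ ^ 2 := by
  let ν := (volume (closedBall x r))⁻¹ • volume.restrict (closedBall x r)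
  have hν : IsProbabilityMeasure ν := by
    constructor
    simp only [ν, Measure.smul_apply, Measure.restrict_apply_univ, smul_eq_mul]
    exact ENNReal.inv_mul_cancel (volume_closedBall_ne_zero x hr) (volume_closedBall_ne_top x r)
  have hm : AEStronglyMeasurable f ν :=
    ((Lp.aestronglyMeasurable f).restrict).smul_measure _
  have h1 : ‖⨍ y in closedBall x r, f y‖ₑ ≤ eLpNorm f 2 ν := by
    refine le_trans ?_ (eLpNorm_le_eLpNorm_of_exponent_le one_le_two hm)
    rw [eLpNorm_one_eq_lintegral_enorm, setAverage_eq']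
    exact enorm_integral_le_lintegral_enorm _
  calc _ ≤ eLpNorm f 2 ν ^ 2 := by gcongr
    _ = ∫⁻ y, ‖f y‖ₑ ^ 2 ∂ν := by
      have := eLpNorm_nnreal_pow_eq_lintegral (f := f) (μ := ν) (p := 2) two_ne_zero
      simpa using this
    _ = _ := by rw [lintegral_smul_measure, smul_eq_mul]

theorem measurable_setAverage {n : ℕ} (f : L2 n) (r : ℝ) (hr : 0 < r) :
    Measurable fun x : Fin n → ℝ => ⨍ y in closedBall x r, f y := by
  have h : ∀ x : Fin n → ℝ, ⨍ y in closedBall x r, f y =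
      (((2 * r) ^ n)⁻¹ : ℝ) • ∫ y, {z : (Fin n → ℝ) × (Fin n → ℝ) | dist z.2 z.1 ≤ r}.indicator
        (fun z => f z.2) (x, y) := by
    intro x
    rw [setAverage_eq, measureReal_def, Real.volume_pi_closedBall _ hr.le,
      ENNReal.toReal_ofReal (by positivity), ← integral_indicator measurableSet_closedBall]
    simp only [Fintype.card_fin]
    rfl
  simp_rw [h]
  refine Measurable.const_smul (StronglyMeasurable.measurable ?_) (((2 * r) ^ n)⁻¹ : ℝ)
  refine (StronglyMeasurable.integral_prod_right ?_)
  refine StronglyMeasurable.indicator ?_ ?_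
  · exact (Lp.stronglyMeasurable f).comp_measurable measurable_snd
  · exact measurableSet_le (by fun_prop) measurable_const

/-- Averaging over balls is a contraction of `L²`. -/
theorem lintegral_enorm_setAverage_sq_le {n : ℕ} (f : L2 n) {r : ℝ} (hr : 0 < r) :
    ∫⁻ x : Fin n → ℝ, ‖⨍ y in closedBall x r, f y‖ₑ ^ 2 ≤ ∫⁻ y, ‖f y‖ₑ ^ 2 := by
  have hV : ∀ x : Fin n → ℝ, volume (closedBall x r) = ENNReal.ofReal ((2 * r) ^ n) := fun x => by
    rw [Real.volume_pi_closedBall _ hr.le, Fintype.card_fin]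
  have h0 : ENNReal.ofReal ((2 * r) ^ n) ≠ 0 := by
    rw [Ne, ENNReal.ofReal_eq_zero, not_le]; positivity
  have hfm : Measurable fun y => ‖f y‖ₑ ^ 2 :=
    ((Lp.stronglyMeasurable f).measurable.enorm).pow_const 2
  have hS : MeasurableSet {z : (Fin n → ℝ) × (Fin n → ℝ) | dist z.2 z.1 ≤ r} :=
    measurableSet_le (by fun_prop) measurable_const
  calc ∫⁻ x : Fin n → ℝ, ‖⨍ y in closedBall x r, f y‖ₑ ^ 2
      ≤ ∫⁻ x : Fin n → ℝ, (ENNReal.ofReal ((2 * r) ^ n))⁻¹ *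
        ∫⁻ y, {z : (Fin n → ℝ) × (Fin n → ℝ) | dist z.2 z.1 ≤ r}.indicator
          (fun z => ‖f z.2‖ₑ ^ 2) (x, y) := by
        refine lintegral_mono fun x => ?_
        refine (enorm_setAverage_sq_le f x hr).trans (le_of_eq ?_)
        rw [hV, ← lintegral_indicator measurableSet_closedBall]
        rfl
    _ = (ENNReal.ofReal ((2 * r) ^ n))⁻¹ * ∫⁻ x : Fin n → ℝ,
        ∫⁻ y, {z : (Fin n → ℝ) × (Fin n → ℝ) | dist z.2 z.1 ≤ r}.indicator
          (fun z => ‖f z.2‖ₑ ^ 2) (x, y) :=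
        lintegral_const_mul' _ _ (ENNReal.inv_ne_top.2 h0)
    _ = (ENNReal.ofReal ((2 * r) ^ n))⁻¹ * ∫⁻ y : Fin n → ℝ,
        ∫⁻ x, {z : (Fin n → ℝ) × (Fin n → ℝ) | dist z.2 z.1 ≤ r}.indicator
          (fun z => ‖f z.2‖ₑ ^ 2) (x, y) := by
        rw [lintegral_lintegral_swap]
        exact ((hfm.comp measurable_snd).indicator hS).aemeasurable
    _ = (ENNReal.ofReal ((2 * r) ^ n))⁻¹ * ∫⁻ y : Fin n → ℝ,
        ENNReal.ofReal ((2 * r) ^ n) * ‖f y‖ₑ ^ 2 := by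
        congr 1
        refine lintegral_congr fun y => ?_
        rw [← hV y, mul_comm, ← lintegral_indicator_const measurableSet_closedBall]
        refine lintegral_congr fun x => ?_
        simp only [Set.indicator, Set.mem_ofPred_eq, mem_closedBall, dist_comm y x]
    _ = _ := by
        rw [lintegral_const_mul _ hfm, ← mul_assoc,
          ENNReal.inv_mul_cancel h0 ENNReal.ofReal_ne_top, one_mul]

theorem lintegral_enorm_sq_eq {n : ℕ} (f : L2 n) :
    ∫⁻ y, ‖f y‖ₑ ^ 2 = ENNReal.ofReal (‖f‖ ^ 2) := by
  rw [norm_sq_eq_integral, ofReal_integral_eq_lintegral_ofReal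
    ((memLp_two_iff_integrable_sq_norm (Lp.aestronglyMeasurable _)).1 (Lp.memLp f))
    (ae_of_all _ fun x => by positivity)]
  refine lintegral_congr fun y => ?_
  rw [ENNReal.ofReal_pow (norm_nonneg _), ofReal_norm]

section

variable {H : Type*} [NormedAddCommGroup H] [InnerProductSpace ℂ H]

theorem eigenvalue_nonneg {T : H →L[ℂ] H} (hT : T.IsPositive) {ι : Type*}
    {b : ι → H} (hb : Orthonormal ℂ b) {l : ι → ℝ} (hl : ∀ i, T (b i) = (l i : ℂ) • b i)
    (i : ι) : 0 ≤ l i := by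
  have h := hT.re_inner_nonneg_right (b i)
  rw [hl, inner_smul_right, inner_self_eq_norm_sq_to_K, hb.1 i] at h
  simpa using h

/-- The quadratic form of a positive operator in terms of an orthonormal basis of eigenvectors. -/
theorem tsum_eigenvalue_mul_enorm_inner_sq {T : H →L[ℂ] H} (hT : T.IsPositive) {ι : Type*}
    (b : HilbertBasis ι ℂ H) {l : ι → ℝ} (hl : ∀ i, T (b i) = (l i : ℂ) • b i) (d : H) :
    ∑' i, ENNReal.ofReal (l i) * ‖⟪d, b i⟫_ℂ‖ₑ ^ 2 =
      ENNReal.ofReal (RCLike.re ⟪d, T d⟫_ℂ) := by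
  have h := b.hasSum_inner_mul_inner d (T d)
  have h1 : ∀ i, ⟪d, b i⟫_ℂ * ⟪b i, T d⟫_ℂ = ((l i * ‖⟪d, b i⟫_ℂ‖ ^ 2 : ℝ) : ℂ) := by
    intro i
    have hsym : ⟪T (b i), d⟫_ℂ = ⟪b i, T d⟫_ℂ := hT.isSymmetric (b i) d
    rw [← hsym, hl, inner_smul_left, ← inner_conj_symm (b i) d]
    simp only [Complex.conj_ofReal]
    rw [mul_left_comm, Complex.mul_conj, Complex.normSq_eq_norm_sq]
    push_cast
    rfl
  simp_rw [h1] at h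
  have h2 := Complex.hasSum_re h
  simp only [Complex.ofReal_re] at h2
  have hn : ∀ i, 0 ≤ l i * ‖⟪d, b i⟫_ℂ‖ ^ 2 := fun i =>
    mul_nonneg (eigenvalue_nonneg hT b.orthonormal hl i) (by positivity)
  change _ = ENNReal.ofReal (Complex.re ⟪d, T d⟫_ℂ)
  rw [← h2.tsum_eq, ENNReal.ofReal_tsum_of_nonneg hn h2.summable]
  refine tsum_congr fun i => ?_
  rw [ENNReal.ofReal_mul (eigenvalue_nonneg hT b.orthonormal hl i),
    ENNReal.ofReal_pow (norm_nonneg _), ofReal_norm]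

end

section

variable {n : ℕ} {κ : (Fin n → ℝ) → (Fin n → ℝ) → ℂ} {T : L2 n →L[ℂ] L2 n}
  {ι : Type*} (b : HilbertBasis ι ℂ (L2 n)) {l : ι → ℝ}

theorem tendsto_one_div_nhdsGT : Tendsto (fun k : ℕ => 1 / ((k : ℝ) + 1)) atTop (𝓝[>] 0) :=
  tendsto_nhdsWithin_iff.2 ⟨tendsto_one_div_add_atTop_nhds_zero_nat,
    Eventually.of_forall fun k => by simp only [Set.mem_Ioi]; positivity⟩

/-- The trace is at most the integral over the diagonal: by Lebesgue differentiation the finite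
sums of `l i * ‖b i x‖ ^ 2` are at most `κ x x` for almost every `x`. -/
theorem tsum_eigenvalue_le (hT : IsIntegralOperator κ T)
    (hc : Continuous fun z : (Fin n → ℝ) × (Fin n → ℝ) => κ z.1 z.2) (hpos : T.IsPositive)
    (hl : ∀ i, T (b i) = (l i : ℂ) • b i) :
    ∑' i, ENNReal.ofReal (l i) ≤ ∫⁻ x, ENNReal.ofReal (κ x x).re := by
  refine ENNReal.summable.tsum_le_of_sum_le fun F => ?_
  have hm : ∀ i, Measurable fun x => ‖b i x‖ₑ ^ 2 := fun i =>
    ((Lp.stronglyMeasurable (b i)).measurable.enorm).pow_const 2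
  have h1 : ∀ i, ENNReal.ofReal (l i) = ∫⁻ x, ENNReal.ofReal (l i) * ‖b i x‖ₑ ^ 2 := by
    intro i
    rw [lintegral_const_mul _ (hm i), lintegral_enorm_sq_eq, b.orthonormal.1 i]
    simp
  rw [Finset.sum_congr rfl fun i _ => h1 i,
    ← lintegral_finsetSum _ fun i _ => (hm i).const_mul _]
  have hF : ∀ᵐ x : Fin n → ℝ, ∀ i ∈ F, Tendsto (fun k : ℕ =>
      ⨍ y in closedBall x (1 / ((k : ℝ) + 1)), b i y) atTop (𝓝 (b i x)) := by
    refine (ae_ball_iff F.countable_toSet).2 fun i _ => ?_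
    have hloc : LocallyIntegrable (b i) volume :=
      (Lp.memLp (b i)).locallyIntegrable one_le_two
    filter_upwards [IsUnifLocDoublingMeasure.ae_tendsto_average volume hloc 1] with x hx
    refine hx (fun _ => x) _ tendsto_one_div_nhdsGT (Eventually.of_forall fun k => ?_)
    exact mem_closedBall_self (by positivity)
  refine lintegral_mono_ae ?_
  filter_upwards [hF] with x hx
  have hlim : Tendsto (fun k : ℕ => ∑ i ∈ F, ENNReal.ofReal (l i) *
      ‖⨍ y in closedBall x (1 / ((k : ℝ) + 1)), b i y‖ₑ ^ 2) atTop
      (𝓝 (∑ i ∈ F, ENNReal.ofReal (l i) * ‖b i x‖ₑ ^ 2)) := by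
    refine tendsto_finsetSum _ fun i hi => ?_
    refine ENNReal.Tendsto.const_mul ?_ (Or.inr ENNReal.ofReal_ne_top)
    exact ENNReal.Tendsto.pow ((hx i hi).enorm)
  have hlim2 := ENNReal.tendsto_ofReal
    ((Complex.continuous_re.tendsto _).comp
      ((tendsto_inner_ballDensity hT hc x).comp tendsto_one_div_nhdsGT))
  refine le_of_tendsto_of_tendsto' hlim hlim2 fun k => ?_
  have := tsum_eigenvalue_mul_enorm_inner_sq hpos b hl
    ((memLp_ballDensity x (1 / ((k : ℝ) + 1))).toLp _)
  refine le_trans (le_trans (le_of_eq ?_) (ENNReal.sum_le_tsum F)) this.le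
  simp_rw [inner_ballDensity]

/-- The integral over the diagonal is at most the trace: this follows from Fatou's lemma, as
averaging over balls does not increase the `L²` norm of the eigenvectors. -/
theorem le_tsum_eigenvalue (hT : IsIntegralOperator κ T)
    (hc : Continuous fun z : (Fin n → ℝ) × (Fin n → ℝ) => κ z.1 z.2) (hpos : T.IsPositive)
    (hl : ∀ i, T (b i) = (l i : ℂ) • b i) :
    ∫⁻ x, ENNReal.ofReal (κ x x).re ≤ ∑' i, ENNReal.ofReal (l i) := by
  by_cases htop : ∑' i, ENNReal.ofReal (l i) = ∞
  · rw [htop]; exact le_top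
  -- Interchanging sum and integral needs countably many terms; only those with `l i ≠ 0` matter.
  have hcount := Summable.countable_support_ennreal htop
  set s : Set ι := Function.support fun i => ENNReal.ofReal (l i) with hs
  have : Countable s := hcount.to_subtype
  let g : ℕ → (Fin n → ℝ) → ℝ≥0∞ := fun k x => ∑' i : s, ENNReal.ofReal (l i) *
      ‖⨍ y in closedBall x (1 / ((k : ℝ) + 1)), b i y‖ₑ ^ 2
  have hk : ∀ k : ℕ, 0 < 1 / ((k : ℝ) + 1) := fun (k : ℕ) => by positivity
  have hgm : ∀ (k : ℕ) (i : ι), Measurable fun x => ENNReal.ofReal (l i) *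
      ‖⨍ y in closedBall x (1 / ((k : ℝ) + 1)), b i y‖ₑ ^ 2 := fun k i =>
    ((measurable_setAverage (b i) _ (hk k)).enorm.pow_const 2).const_mul _
  have hg : ∀ (k : ℕ) (x : Fin n → ℝ), g k x = ENNReal.ofReal (Complex.re
      ⟪(memLp_ballDensity x (1 / ((k : ℝ) + 1))).toLp _,
        T ((memLp_ballDensity x (1 / ((k : ℝ) + 1))).toLp _)⟫_ℂ) := by
    intro k x
    have := tsum_eigenvalue_mul_enorm_inner_sq hpos b hl
      ((memLp_ballDensity x (1 / ((k : ℝ) + 1))).toLp _)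
    refine Eq.trans ?_ this
    simp_rw [inner_ballDensity]
    refine tsum_subtype_eq_of_support_subset (f := fun i => ENNReal.ofReal (l i) *
      ‖⨍ y in closedBall x (1 / ((k : ℝ) + 1)), b i y‖ₑ ^ 2) fun i hi => ?_
    exact left_ne_zero_of_mul hi
  have hlim : ∀ x, Tendsto (fun k => g k x) atTop (𝓝 (ENNReal.ofReal (κ x x).re)) := by
    intro x
    simp_rw [hg]
    exact ENNReal.tendsto_ofReal ((Complex.continuous_re.tendsto _).comp
      ((tendsto_inner_ballDensity hT hc x).comp tendsto_one_div_nhdsGT))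
  calc ∫⁻ x, ENNReal.ofReal (κ x x).re = ∫⁻ x, liminf (fun k => g k x) atTop :=
        lintegral_congr fun x => (hlim x).liminf_eq.symm
    _ ≤ liminf (fun k => ∫⁻ x, g k x) atTop :=
        lintegral_liminf_le fun k => Measurable.tsum fun i => hgm k i
    _ ≤ liminf (fun _ : ℕ => ∑' i, ENNReal.ofReal (l i)) atTop := by
        refine liminf_le_liminf (Eventually.of_forall fun k => ?_)
        simp only [g]
        rw [lintegral_tsum fun i : s => (hgm k i).aemeasurable,
          ← tsum_subtype_eq_of_support_subset (s := s) subset_rfl]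
        refine ENNReal.tsum_le_tsum fun i => ?_
        rw [lintegral_const_mul _ ((measurable_setAverage (b i) _ (hk k)).enorm.pow_const 2)]
        refine (mul_le_mul_right (lintegral_enorm_setAverage_sq_le (b i) (hk k)) _).trans ?_
        rw [lintegral_enorm_sq_eq, b.orthonormal.1 i]
        simp
    _ = _ := liminf_const _

/-- The trace formula: the eigenvalues of a positive integral operator with continuous kernel
sum to the integral of the kernel over the diagonal. -/
theorem tsum_eigenvalue_eq (hT : IsIntegralOperator κ T)
    (hc : Continuous fun z : (Fin n → ℝ) × (Fin n → ℝ) => κ z.1 z.2) (hpos : T.IsPositive)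
    (hl : ∀ i, T (b i) = (l i : ℂ) • b i) :
    ∑' i, ENNReal.ofReal (l i) = ∫⁻ x, ENNReal.ofReal (κ x x).re :=
  le_antisymm (tsum_eigenvalue_le b hT hc hpos hl) (le_tsum_eigenvalue b hT hc hpos hl)

end

theorem lintegral_diagonal_eq {n : ℕ} {κ : (Fin n → ℝ) → (Fin n → ℝ) → ℂ} {T : L2 n →L[ℂ] L2 n}
    (hT : IsIntegralOperator κ T)
    (hc : Continuous fun z : (Fin n → ℝ) × (Fin n → ℝ) => κ z.1 z.2) (hpos : T.IsPositive)
    {t : ℝ} (ht : HasTrace T t) :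
    ∫⁻ x, ENNReal.ofReal (κ x x).re = ENNReal.ofReal t := by
  obtain ⟨ι, b, l, hl, hsum⟩ := ht
  rw [← tsum_eigenvalue_eq b hT hc hpos hl, ← hsum.tsum_eq,
    ENNReal.ofReal_tsum_of_nonneg (eigenvalue_nonneg hpos b.orthonormal hl) hsum.summable]

/-- A positive integral operator with continuous kernel is trace-class as soon as the kernel is
integrable over the diagonal, and its trace is the integral. -/
theorem hasTrace_of_lintegral_diagonal_eq {n : ℕ} {κ : (Fin n → ℝ) → (Fin n → ℝ) → ℂ}
    {T : L2 n →L[ℂ] L2 n} (hT : IsIntegralOperator κ T)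
    (hc : Continuous fun z : (Fin n → ℝ) × (Fin n → ℝ) => κ z.1 z.2) (hpos : T.IsPositive)
    {t : ℝ} (h0 : 0 ≤ t) (ht : ∫⁻ x, ENNReal.ofReal (κ x x).re = ENNReal.ofReal t) :
    HasTrace T t := by
  obtain ⟨w, e, -⟩ := exists_hilbertBasis ℂ (L2 n)
  have hcomp : IsCompactOperator T :=
    isCompactOperator_of_sum_norm_sq_le e T fun F => hT.sum_norm_sq_le e.orthonormal F
  obtain ⟨ι, b, l, hl⟩ := exists_eigenbasis hcomp hpos.isSymmetric
  refine ⟨ι, b, l, hl, ?_⟩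
  have h1 := tsum_eigenvalue_eq b hT hc hpos hl
  rw [ht] at h1
  have hnn := eigenvalue_nonneg hpos b.orthonormal hl
  have hs : Summable l := by
    have := ENNReal.summable_toReal (h1.trans_ne ENNReal.ofReal_ne_top)
    simpa [ENNReal.toReal_ofReal (hnn _)] using this
  rw [← ENNReal.ofReal_tsum_of_nonneg hnn hs,
    ENNReal.ofReal_eq_ofReal_iff (tsum_nonneg hnn) h0] at h1
  rw [← h1]
  exact hs.hasSum

/-! ### Entire functions on tubes and the shift of the domain of integration -/

/-- A real vector, viewed as a complex vector. -/
def complexify {σ : Type*} (x : σ → ℝ) : σ → ℂ := fun i => (x i : ℂ)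

/-- The `ℓ¹` norm of a real vector. -/
def l1norm {σ : Type*} [Fintype σ] (x : σ → ℝ) : ℝ := ∑ i, |x i|

theorem continuous_complexify {σ : Type*} : Continuous (complexify : (σ → ℝ) → σ → ℂ) := by
  unfold complexify; fun_prop

section

variable {σ : Type*} [Fintype σ]

theorem l1norm_nonneg (x : σ → ℝ) : 0 ≤ l1norm x := Finset.sum_nonneg fun _ _ => abs_nonneg _

theorem abs_le_l1norm (x : σ → ℝ) (i : σ) : |x i| ≤ l1norm x :=
  Finset.single_le_sum (f := fun i => |x i|) (fun _ _ => abs_nonneg _) (Finset.mem_univ i)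

/-- Entire functions of several variables that grow at most exponentially in the real directions,
uniformly on each tube of points with bounded distance to the real subspace. -/
structure ModerateOnTubes (h : (σ → ℂ) → ℂ) : Prop where
  differentiable : Differentiable ℂ h
  bound : ∀ R : ℝ, ∃ C k : ℝ, 0 ≤ C ∧ 0 ≤ k ∧
    ∀ (x : σ → ℝ) (w : σ → ℂ), ‖w‖ ≤ R → ‖h (complexify x + w)‖ ≤ C * Real.exp (k * l1norm x)

/-- Entire functions of several variables that decay faster than every exponential in the real
directions, uniformly on each tube of points with bounded distance to the real subspace. -/
structure RapidOnTubes (h : (σ → ℂ) → ℂ) : Prop where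
  differentiable : Differentiable ℂ h
  bound : ∀ R k : ℝ, ∃ C : ℝ, 0 ≤ C ∧
    ∀ (x : σ → ℝ) (w : σ → ℂ), ‖w‖ ≤ R → ‖h (complexify x + w)‖ ≤ C * Real.exp (-k * l1norm x)

namespace ModerateOnTubes

theorem const (c : ℂ) : ModerateOnTubes fun _ : σ → ℂ => c :=
  ⟨by fun_prop, fun _ => ⟨‖c‖, 0, norm_nonneg _, le_rfl, fun x w _ => by simp⟩⟩

theorem coord (i : σ) : ModerateOnTubes fun u : σ → ℂ => u i := by
  refine ⟨by fun_prop, fun R => ⟨1 + |R|, 1, by positivity, zero_le_one, fun x w hw => ?_⟩⟩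
  have h1 : ‖w i‖ ≤ |R| := ((norm_le_pi_norm w i).trans hw).trans (le_abs_self R)
  have h2 : ‖(x i : ℂ)‖ ≤ l1norm x := by
    rw [Complex.norm_real]; exact abs_le_l1norm x i
  have h3 := Real.add_one_le_exp (l1norm x)
  have h4 : 1 ≤ Real.exp (l1norm x) := Real.one_le_exp (l1norm_nonneg x)
  calc ‖(complexify x + w) i‖ ≤ ‖(x i : ℂ)‖ + ‖w i‖ := norm_add_le _ _
    _ ≤ (1 + |R|) * Real.exp (1 * l1norm x) := by
      rw [one_mul]; nlinarith [abs_nonneg R]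

theorem add {f g : (σ → ℂ) → ℂ} (hf : ModerateOnTubes f) (hg : ModerateOnTubes g) :
    ModerateOnTubes fun u => f u + g u := by
  refine ⟨hf.differentiable.add hg.differentiable, fun R => ?_⟩
  obtain ⟨C, k, hC, hk, h⟩ := hf.bound R
  obtain ⟨C', k', hC', hk', h'⟩ := hg.bound R
  refine ⟨C + C', k + k', by positivity, by positivity, fun x w hw => ?_⟩
  refine (norm_add_le _ _).trans ?_
  rw [add_mul]
  have hx := l1norm_nonneg x
  refine add_le_add ((h x w hw).trans ?_) ((h' x w hw).trans ?_)
  · gcongr; linarith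
  · gcongr; linarith

theorem mul {f g : (σ → ℂ) → ℂ} (hf : ModerateOnTubes f) (hg : ModerateOnTubes g) :
    ModerateOnTubes fun u => f u * g u := by
  refine ⟨hf.differentiable.mul hg.differentiable, fun R => ?_⟩
  obtain ⟨C, k, hC, hk, h⟩ := hf.bound R
  obtain ⟨C', k', hC', hk', h'⟩ := hg.bound R
  refine ⟨C * C', k + k', by positivity, by positivity, fun x w hw => ?_⟩
  rw [norm_mul, add_mul, Real.exp_add, mul_mul_mul_comm]
  exact mul_le_mul (h x w hw) (h' x w hw) (norm_nonneg _) ((norm_nonneg _).trans (h x w hw))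

/-- Polynomials have moderate growth. -/
theorem eval (p : MvPolynomial σ ℂ) : ModerateOnTubes fun u => MvPolynomial.eval u p := by
  induction p using MvPolynomial.induction_on with
  | C a => simpa using const a
  | add p q hp hq => simpa using hp.add hq
  | mul_X p i hp => simpa using hp.mul (coord i)

theorem exp_linear (z : σ → ℂ) : ModerateOnTubes fun u : σ → ℂ => Complex.exp (z ⬝ᵥ u) := by
  refine ⟨by simp only [dotProduct]; fun_prop, fun R => ?_⟩
  have h1 : ∀ u : σ → ℂ, ‖z ⬝ᵥ u‖ ≤ ‖z‖ * ∑ i, ‖u i‖ := by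
    intro u
    rw [Finset.mul_sum]
    refine (norm_sum_le _ _).trans (Finset.sum_le_sum fun i _ => ?_)
    rw [norm_mul]
    gcongr
    exact norm_le_pi_norm z i
  refine ⟨Real.exp (‖z‖ * (Fintype.card σ * |R|)), ‖z‖, by positivity, norm_nonneg _,
    fun x w hw => ?_⟩
  rw [Complex.norm_exp, ← Real.exp_add]
  gcongr
  refine (Complex.re_le_norm _).trans ?_
  rw [dotProduct_add, add_comm]
  refine (norm_add_le _ _).trans (add_le_add ((h1 w).trans ?_) ((h1 _).trans ?_))
  · gcongr
    calc ∑ i, ‖w i‖ ≤ ∑ _i : σ, |R| := Finset.sum_le_sum fun i _ =>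
          ((norm_le_pi_norm w i).trans hw).trans (le_abs_self R)
      _ = _ := by simp
  · simp [complexify, l1norm]

end ModerateOnTubes

namespace RapidOnTubes

theorem add {f g : (σ → ℂ) → ℂ} (hf : RapidOnTubes f) (hg : RapidOnTubes g) :
    RapidOnTubes fun u => f u + g u := by
  refine ⟨hf.differentiable.add hg.differentiable, fun R k => ?_⟩
  obtain ⟨C, hC, h⟩ := hf.bound R k
  obtain ⟨C', hC', h'⟩ := hg.bound R k
  refine ⟨C + C', by positivity, fun x w hw => ?_⟩
  rw [add_mul]
  exact (norm_add_le _ _).trans (add_le_add (h x w hw) (h' x w hw))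

theorem mul_moderate {f g : (σ → ℂ) → ℂ} (hf : RapidOnTubes f) (hg : ModerateOnTubes g) :
    RapidOnTubes fun u => f u * g u := by
  refine ⟨hf.differentiable.mul hg.differentiable, fun R k => ?_⟩
  obtain ⟨C', k', hC', hk', h'⟩ := hg.bound R
  obtain ⟨C, hC, h⟩ := hf.bound R (k + k')
  refine ⟨C * C', by positivity, fun x w hw => ?_⟩
  have : -k * l1norm x = -(k + k') * l1norm x + k' * l1norm x := by ring
  rw [norm_mul, this, Real.exp_add, mul_mul_mul_comm]
  exact mul_le_mul (h x w hw) (h' x w hw) (norm_nonneg _) ((norm_nonneg _).trans (h x w hw))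

theorem const_mul (c : ℂ) {f : (σ → ℂ) → ℂ} (hf : RapidOnTubes f) :
    RapidOnTubes fun u => c * f u := by
  simpa [mul_comm] using hf.mul_moderate (ModerateOnTubes.const c)

theorem comp_add {f : (σ → ℂ) → ℂ} (hf : RapidOnTubes f) (a : σ → ℂ) :
    RapidOnTubes fun u => f (u + a) := by
  refine ⟨hf.differentiable.comp (by fun_prop), fun R k => ?_⟩
  obtain ⟨C, hC, h⟩ := hf.bound (R + ‖a‖) k
  refine ⟨C, hC, fun x w hw => ?_⟩
  rw [add_assoc]
  exact h x (w + a) ((norm_add_le _ _).trans (by gcongr))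

/-- The analytic continuation of the complex conjugate of `f` from the real subspace. -/
theorem conj_conj {f : (σ → ℂ) → ℂ} (hf : RapidOnTubes f) :
    RapidOnTubes fun u => conj (f fun i => conj (u i)) := by
  refine ⟨fun u => ?_, fun R k => ?_⟩
  · simpa using! (hf.differentiable (star u)).star_star
  · obtain ⟨C, hC, h⟩ := hf.bound R k
    refine ⟨C, hC, fun x w hw => ?_⟩
    have h1 : (fun i => conj ((complexify x + w) i)) = complexify x + star w := by
      ext i; simp [complexify]
    rw [RCLike.norm_conj, h1]
    exact h x (star w) (by rwa [norm_star])

theorem gaussian : RapidOnTubes fun u : σ → ℂ => Complex.exp (-(u ⬝ᵥ u)) := by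
  refine ⟨by simp only [dotProduct]; fun_prop, fun R k => ?_⟩
  refine ⟨Real.exp (∑ _i : σ, (R ^ 2 + (2 * |R| + |k|) ^ 2)), by positivity, fun x w hw => ?_⟩
  rw [Complex.norm_exp, ← Real.exp_add]
  gcongr
  rw [l1norm, Finset.mul_sum, ← Finset.sum_add_distrib, dotProduct, ← Finset.sum_neg_distrib,
    Complex.re_sum]
  refine Finset.sum_le_sum fun i _ => ?_
  have hwi : ‖w i‖ ≤ R := (norm_le_pi_norm w i).trans hw
  have hre : |(w i).re| ≤ |R| := ((Complex.abs_re_le_norm _).trans hwi).trans (le_abs_self R)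
  have him : (w i).im ^ 2 ≤ R ^ 2 :=
    sq_le_sq' (by linarith [(abs_le.1 ((Complex.abs_im_le_norm _).trans hwi)).1])
      (abs_le.1 ((Complex.abs_im_le_norm _).trans hwi)).2
  have hval : (-((complexify x + w) i * (complexify x + w) i)).re =
      -(x i + (w i).re) ^ 2 + (w i).im ^ 2 := by
    simp [complexify]; ring
  rw [hval]
  have h1 : -(2 * x i * (w i).re) ≤ 2 * (|x i| * |R|) := by
    have : -(x i * (w i).re) ≤ |x i| * |(w i).re| := by
      rw [← abs_mul]; exact neg_le_abs _
    nlinarith [abs_nonneg (x i)]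
  have h2 : k * |x i| ≤ |k| * |x i| := by gcongr; exact le_abs_self k
  nlinarith [sq_abs (x i), sq_nonneg (|x i| - (2 * |R| + |k|)), sq_nonneg (w i).re,
    abs_nonneg (x i), abs_nonneg k, abs_nonneg R]

theorem norm_le {f : (σ → ℂ) → ℂ} (hf : RapidOnTubes f) :
    ∃ C, ∀ x : σ → ℝ, ‖f (complexify x)‖ ≤ C * Real.exp (-l1norm x) := by
  obtain ⟨C, -, h⟩ := hf.bound 0 1
  exact ⟨C, fun x => by simpa using h x 0 (by simp)⟩

end RapidOnTubes

theorem integrable_exp_neg_l1norm : Integrable fun x : σ → ℝ => Real.exp (-l1norm x) := by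
  have h1 : Integrable fun t : ℝ => Real.exp (-|t|) := by
    refine (integrable_inv_one_add_sq.const_mul 2).mono' (by fun_prop) (ae_of_all _ fun t => ?_)
    have h := Real.quadratic_le_exp_of_nonneg (abs_nonneg t)
    rw [sq_abs] at h
    rw [Real.norm_of_nonneg (by positivity), Real.exp_neg, ← div_eq_mul_inv,
      inv_le_comm₀ (by positivity) (by positivity), inv_div]
    linarith [abs_nonneg t]
  have h2 := Integrable.fintype_prod (ι := σ) (f := fun _ t => Real.exp (-|t|)) fun _ => h1
  refine h2.congr (ae_of_all _ fun x => ?_)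
  simp only [l1norm]
  rw [← Real.exp_sum, Finset.sum_neg_distrib]

theorem RapidOnTubes.integrable {f : (σ → ℂ) → ℂ} (hf : RapidOnTubes f) :
    Integrable fun x : σ → ℝ => f (complexify x) := by
  obtain ⟨C, h⟩ := hf.norm_le
  refine (integrable_exp_neg_l1norm.const_mul C).mono' ?_ (ae_of_all _ h)
  exact (hf.differentiable.continuous.comp continuous_complexify).aestronglyMeasurable

theorem RapidOnTubes.memLp {f : (σ → ℂ) → ℂ} (hf : RapidOnTubes f) :
    MemLp (fun x : σ → ℝ => f (complexify x)) 2 volume := by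
  have hm : AEStronglyMeasurable (fun x : σ → ℝ => f (complexify x)) volume :=
    (hf.differentiable.continuous.comp continuous_complexify).aestronglyMeasurable
  rw [memLp_two_iff_integrable_sq_norm hm]
  obtain ⟨C, h⟩ := hf.norm_le
  refine (integrable_exp_neg_l1norm.const_mul (C ^ 2)).mono' (hm.norm.pow 2)
    (ae_of_all _ fun x => ?_)
  rw [Real.norm_of_nonneg (by positivity)]
  refine (pow_le_pow_left₀ (norm_nonneg _) (h x) 2).trans ?_
  rw [mul_pow, ← Real.exp_nat_mul]
  gcongr
  have := l1norm_nonneg x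
  push_cast
  linarith

end

theorem tendsto_one_div_nhdsNE :
    Tendsto (fun k : ℕ => ((1 / ((k : ℝ) + 1) : ℝ) : ℂ)) atTop (𝓝[≠] 0) := by
  refine tendsto_nhdsWithin_iff.2 ⟨?_, Eventually.of_forall fun k => ?_⟩
  · have := (Complex.continuous_ofReal.tendsto 0).comp
      (tendsto_one_div_add_atTop_nhds_zero_nat (𝕜 := ℝ))
    rwa [Complex.ofReal_zero] at this
  · simp only [Set.mem_compl_iff, Set.mem_singleton_iff, Complex.ofReal_eq_zero]
    positivity

/-- A locally dominated integral of entire functions is entire. -/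
theorem differentiable_integral {X : Type*} [MeasurableSpace X] {μ : Measure X}
    {Φ : ℂ → X → ℂ} (hd : ∀ x, Differentiable ℂ fun ζ => Φ ζ x)
    (hm : ∀ ζ, AEStronglyMeasurable (Φ ζ) μ)
    (hb : ∀ R : ℝ, ∃ g : X → ℝ, Integrable g μ ∧ ∀ ζ x, ‖ζ‖ ≤ R → ‖Φ ζ x‖ ≤ g x) :
    Differentiable ℂ fun ζ => ∫ x, Φ ζ x ∂μ := by
  intro ζ₀
  obtain ⟨g, hg, hbg⟩ := hb (‖ζ₀‖ + 2)
  have hderiv : ∀ ζ x, HasDerivAt (fun ζ => Φ ζ x) (deriv (fun ζ => Φ ζ x) ζ) ζ := fun ζ x =>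
    (hd x ζ).hasDerivAt
  refine (hasDerivAt_integral_of_dominated_loc_of_deriv_le (s := ball ζ₀ 1)
    (F' := fun ζ x => deriv (fun ζ => Φ ζ x) ζ) (bound := g) (ball_mem_nhds _ one_pos)
    (Eventually.of_forall hm) (hg.mono' (hm ζ₀) (ae_of_all _ fun x => hbg ζ₀ x (by linarith)))
    ?_ (ae_of_all _ fun x ζ hζ => ?_) hg
    (ae_of_all _ fun x ζ _ => hderiv ζ x)).2.differentiableAt
  · have hlim : ∀ x, Tendsto (fun k : ℕ => ((1 / ((k : ℝ) + 1) : ℝ) : ℂ)⁻¹ •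
        (Φ (ζ₀ + ((1 / ((k : ℝ) + 1) : ℝ) : ℂ)) x - Φ ζ₀ x)) atTop
        (𝓝 (deriv (fun ζ => Φ ζ x) ζ₀)) := by
      intro x
      have h1 := (hderiv ζ₀ x).tendsto_slope_zero
      exact h1.comp tendsto_one_div_nhdsNE
    refine aestronglyMeasurable_of_tendsto_ae atTop (fun k => ?_) (ae_of_all _ hlim)
    exact ((hm _).sub (hm _)).const_smul (((1 / ((k : ℝ) + 1) : ℝ) : ℂ)⁻¹)
  -- Cauchy's estimate bounds the derivative by the bound of the function on a larger disc.
  · have := Complex.norm_deriv_le_of_forall_mem_sphere_norm_le (c := ζ) (C := g x) one_pos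
      (hd x).diffContOnCl fun z hz => hbg z x ?_
    · simpa using this
    · have h1 : ‖z - ζ‖ = 1 := by rwa [← dist_eq_norm]
      have h2 : ‖ζ - ζ₀‖ < 1 := by rwa [← dist_eq_norm]
      calc ‖z‖ = ‖(z - ζ) + (ζ - ζ₀) + ζ₀‖ := by congr 1; ring
        _ ≤ ‖z - ζ‖ + ‖ζ - ζ₀‖ + ‖ζ₀‖ := norm_add₃_le
        _ ≤ _ := by linarith

/-- Contour shift: the integral over the real subspace does not change if the subspace is
translated by a complex vector. -/
theorem RapidOnTubes.integral_add_eq {σ : Type*} [Fintype σ] {f : (σ → ℂ) → ℂ}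
    (hf : RapidOnTubes f) (a : σ → ℂ) :
    ∫ x : σ → ℝ, f (complexify x + a) = ∫ x : σ → ℝ, f (complexify x) := by
  -- Only the imaginary part of `a` is scaled by `ζ`. The integral of `Φ ζ` is entire in `ζ`, and
  -- for real `ζ` it is constant by translation invariance.
  let Φ : ℂ → (σ → ℝ) → ℂ := fun ζ x =>
    f (complexify x + (complexify (fun i => (a i).re) + ζ • complexify fun i => (a i).im))
  have hd : Differentiable ℂ fun ζ => ∫ x, Φ ζ x := by
    refine differentiable_integral (fun x => ?_) (fun ζ => ?_) fun R => ?_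
    · exact hf.differentiable.comp (by fun_prop)
    · exact (hf.differentiable.continuous.comp
        (continuous_complexify.add continuous_const)).aestronglyMeasurable
    · obtain ⟨C, hC, h⟩ := hf.bound (‖complexify fun i => (a i).re‖ +
        |R| * ‖complexify fun i => (a i).im‖) 1
      refine ⟨_, integrable_exp_neg_l1norm.const_mul C, fun ζ x hζ => ?_⟩
      have := h x (complexify (fun i => (a i).re) + ζ • complexify fun i => (a i).im) (by
        refine (norm_add_le _ _).trans ?_
        rw [norm_smul]
        gcongr
        exact hζ.trans (le_abs_self R))
      simpa using this
  have hreal : ∀ t : ℝ, ∫ x, Φ t x = ∫ x : σ → ℝ, f (complexify x) := by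
    intro t
    rw [← integral_add_right_eq_self (fun x : σ → ℝ => f (complexify x))
      ((fun i => (a i).re) + t • fun i => (a i).im)]
    refine integral_congr_ae (ae_of_all _ fun x => ?_)
    simp only [Φ]
    congr 1
    ext i
    simp [complexify]
  have heq : (fun ζ => ∫ x, Φ ζ x) = fun _ => ∫ x : σ → ℝ, f (complexify x) := by
    refine AnalyticOnNhd.eq_of_frequently_eq (z₀ := 0)
      (fun z _ => hd.analyticAt z) (fun z _ => analyticAt_const) ?_
    exact tendsto_one_div_nhdsNE.frequently (Frequently.of_forall fun k => hreal _)
  rw [← congrFun heq Complex.I]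
  refine integral_congr_ae (ae_of_all _ fun x => ?_)
  simp only [Φ]
  congr 2
  ext i
  simp only [complexify, Pi.add_apply, Pi.smul_apply, smul_eq_mul]
  rw [mul_comm, Complex.re_add_im]

/-! ### Density of entire functions in `L²` and products of test functions -/

/-- An integrable real function whose Fourier transform vanishes is zero: its positive and its
negative part are densities of measures with the same characteristic function. -/
theorem ae_eq_zero_of_integral_exp_mul_ofReal_eq_zero {n : ℕ} {F : (Fin n → ℝ) → ℝ}
    (hF : Integrable F)
    (h : ∀ v : Fin n → ℝ, ∫ x, Complex.exp (((v ⬝ᵥ x : ℝ) : ℂ) * Complex.I) * (F x : ℂ) = 0) :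
    F =ᵐ[volume] 0 := by
  have hm : AEMeasurable F := hF.1.aemeasurable
  let P : Measure (Fin n → ℝ) := volume.withDensity fun x => ENNReal.ofReal (F x)
  let N : Measure (Fin n → ℝ) := volume.withDensity fun x => ENNReal.ofReal (-F x)
  have hm' : AEMeasurable fun x => -F x := hm.neg
  have hP : IsFiniteMeasure P := isFiniteMeasure_withDensity_ofReal hF.2
  have hN : IsFiniteMeasure N := isFiniteMeasure_withDensity_ofReal hF.neg.2
  have hexp : ∀ L : StrongDual ℝ (Fin n → ℝ),
      Continuous fun x => Complex.exp ((L x : ℂ) * Complex.I) := fun L => by fun_prop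
  have hbd : ∀ (L : StrongDual ℝ (Fin n → ℝ)) x, ‖Complex.exp ((L x : ℂ) * Complex.I)‖ ≤ 1 :=
    fun L x => (Complex.norm_exp_ofReal_mul_I _).le
  have hPN : P = N := by
    refine Measure.ext_of_charFunDual ?_
    ext L
    rw [charFunDual_apply, charFunDual_apply,
      integral_withDensity_eq_integral_toReal_smul₀ hm.ennreal_ofReal
        (ae_of_all _ fun _ => ENNReal.ofReal_lt_top),
      integral_withDensity_eq_integral_toReal_smul₀ hm'.ennreal_ofReal
        (ae_of_all _ fun _ => ENNReal.ofReal_lt_top), ← sub_eq_zero, ← integral_sub]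
    · rw [← h fun i => L (Pi.single i 1)]
      refine integral_congr_ae (ae_of_all _ fun x => ?_)
      have hL : L x = (fun i => L (Pi.single i 1)) ⬝ᵥ x := by
        have := LinearMap.pi_apply_eq_sum_univ (L : (Fin n → ℝ) →ₗ[ℝ] ℝ) x
        simp only [ContinuousLinearMap.coe_coe, smul_eq_mul] at this
        rw [this, dotProduct]
        refine Finset.sum_congr rfl fun i _ => ?_
        rw [mul_comm]
        congr 2
        ext j
        simp [Pi.single_apply, eq_comm]
      simp only [← hL, ← sub_smul, ENNReal.toReal_ofReal']
      have : max (F x) 0 - max (-F x) 0 = F x := by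
        rcases le_total 0 (F x) with h0 | h0 <;> simp [h0]
      rw [this, Complex.real_smul, mul_comm]
    · exact ((hF.pos_part.ofReal (𝕜 := ℂ)).bdd_mul (hexp L).aestronglyMeasurable
        (ae_of_all _ (hbd L))).congr (ae_of_all _ fun x => by
          simp only [ENNReal.toReal_ofReal', Complex.real_smul]
          exact mul_comm _ _)
    · exact ((hF.neg_part.ofReal (𝕜 := ℂ)).bdd_mul (hexp L).aestronglyMeasurable
        (ae_of_all _ (hbd L))).congr (ae_of_all _ fun x => by
          simp only [ENNReal.toReal_ofReal', Complex.real_smul]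
          exact mul_comm _ _)
  have hae := (withDensity_eq_iff hm.ennreal_ofReal hm'.ennreal_ofReal
    hF.lintegral_lt_top.ne).1 hPN
  filter_upwards [hae] with x hx
  have h1 := congrArg ENNReal.toReal hx
  rw [ENNReal.toReal_ofReal', ENNReal.toReal_ofReal'] at h1
  rw [Pi.zero_apply]
  rcases le_total 0 (F x) with h0 | h0 <;> simp [h0] at h1 <;> linarith

/-- The Fourier transform is injective on integrable functions. -/
theorem ae_eq_zero_of_integral_exp_mul_eq_zero {n : ℕ} {F : (Fin n → ℝ) → ℂ}
    (hF : Integrable F)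
    (h : ∀ v : Fin n → ℝ, ∫ x, Complex.exp (((v ⬝ᵥ x : ℝ) : ℂ) * Complex.I) * F x = 0) :
    F =ᵐ[volume] 0 := by
  have hi : ∀ (v : Fin n → ℝ) (G : (Fin n → ℝ) → ℂ), Integrable G →
      Integrable fun x => Complex.exp (((v ⬝ᵥ x : ℝ) : ℂ) * Complex.I) * G x := fun v G hG =>
    hG.bdd_mul (Continuous.aestronglyMeasurable (by simp only [dotProduct]; fun_prop))
      (ae_of_all _ fun x => (Complex.norm_exp_ofReal_mul_I _).le)
  have hconj : ∀ v : Fin n → ℝ,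
      ∫ x, Complex.exp (((v ⬝ᵥ x : ℝ) : ℂ) * Complex.I) * conj (F x) = 0 := by
    intro v
    have := congrArg conj (h (-v))
    rw [← integral_conj, map_zero] at this
    rw [← this]
    refine integral_congr_ae (ae_of_all _ fun x => ?_)
    simp [← Complex.exp_conj]
  have hFc : Integrable fun x => conj (F x) :=
    (Complex.conjCLE : ℂ →L[ℝ] ℂ).integrable_comp hF
  have hre : (fun x => (F x).re) =ᵐ[volume] 0 := by
    refine ae_eq_zero_of_integral_exp_mul_ofReal_eq_zero hF.re fun v => ?_
    have h1 : ∀ x, Complex.exp (((v ⬝ᵥ x : ℝ) : ℂ) * Complex.I) * ((F x).re : ℂ) =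
        (1 / 2) * (Complex.exp (((v ⬝ᵥ x : ℝ) : ℂ) * Complex.I) * F x +
          Complex.exp (((v ⬝ᵥ x : ℝ) : ℂ) * Complex.I) * conj (F x)) := fun x => by
      rw [Complex.re_eq_add_conj]; ring
    simp_rw [h1]
    rw [integral_const_mul, integral_add (hi v _ hF) (hi v _ hFc), h, hconj]
    simp
  have him : (fun x => (F x).im) =ᵐ[volume] 0 := by
    refine ae_eq_zero_of_integral_exp_mul_ofReal_eq_zero hF.im fun v => ?_
    have h1 : ∀ x, Complex.exp (((v ⬝ᵥ x : ℝ) : ℂ) * Complex.I) * ((F x).im : ℂ) =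
        (1 / (2 * Complex.I)) * (Complex.exp (((v ⬝ᵥ x : ℝ) : ℂ) * Complex.I) * F x -
          Complex.exp (((v ⬝ᵥ x : ℝ) : ℂ) * Complex.I) * conj (F x)) := fun x => by
      rw [Complex.im_eq_sub_conj]; ring
    simp_rw [h1]
    rw [integral_const_mul, integral_sub (hi v _ hF) (hi v _ hFc), h, hconj]
    simp
  filter_upwards [hre, him] with x h1 h2
  exact Complex.ext h1 h2

/-- The square integrable functions that are restrictions of entire functions with rapid decay
on tubes. -/
def rapidSubmodule (n : ℕ) : Submodule ℂ (L2 n) where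
  carrier := {f | ∃ g : (Fin n → ℂ) → ℂ, RapidOnTubes g ∧ f =ᵐ[volume] fun x => g (complexify x)}
  add_mem' := by
    rintro f f' ⟨g, hg, hf⟩ ⟨g', hg', hf'⟩
    refine ⟨_, hg.add hg', ?_⟩
    filter_upwards [hf, hf', Lp.coeFn_add f f'] with x h1 h2 h3
    rw [h3, Pi.add_apply, h1, h2]
  zero_mem' := by
    refine ⟨_, RapidOnTubes.gaussian.const_mul 0, ?_⟩
    filter_upwards [Lp.coeFn_zero ℂ 2 (volume : Measure (Fin n → ℝ))] with x hx
    rw [hx, zero_mul, Pi.zero_apply]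
  smul_mem' := by
    rintro c f ⟨g, hg, hf⟩
    refine ⟨_, hg.const_mul c, ?_⟩
    filter_upwards [hf, Lp.coeFn_smul c f] with x h1 h2
    rw [h2, Pi.smul_apply, h1, smul_eq_mul]

/-- A function orthogonal to all products of the Gaussian `exp (-x ⬝ᵥ x)` with characters vanishes,
since its product with the Gaussian has vanishing Fourier transform. -/
theorem dense_rapidSubmodule (n : ℕ) : Dense (rapidSubmodule n : Set (L2 n)) := by
  rw [Submodule.dense_iff_topologicalClosure_eq_top,
    Submodule.topologicalClosure_eq_top_iff, Submodule.eq_bot_iff]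
  intro h hh
  have hgi : RapidOnTubes fun u : Fin n → ℂ => Complex.exp (-(u ⬝ᵥ u)) := RapidOnTubes.gaussian
  have hint : Integrable fun x : Fin n → ℝ =>
      Complex.exp (-(complexify x ⬝ᵥ complexify x)) * h x :=
    hgi.memLp.integrable_mul (Lp.memLp h)
  have hz := ae_eq_zero_of_integral_exp_mul_eq_zero hint fun v => by
    have hg := hgi.mul_moderate
      (ModerateOnTubes.exp_linear (σ := Fin n) fun i => -((v i : ℂ) * Complex.I))
    have h0 := (Submodule.mem_orthogonal _ _).1 hh _ ⟨_, hg, hg.memLp.coeFn_toLp⟩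
    rw [L2.inner_def] at h0
    rw [← h0]
    refine integral_congr_ae ?_
    filter_upwards [hg.memLp.coeFn_toLp] with x hx
    rw [hx, RCLike.inner_apply, map_mul, ← Complex.exp_conj, ← Complex.exp_conj]
    have e1 : conj (-(complexify x ⬝ᵥ complexify x)) = -(complexify x ⬝ᵥ complexify x) := by
      simp [dotProduct, complexify]
    have e2 : conj ((fun i => -((v i : ℂ) * Complex.I)) ⬝ᵥ complexify x) =
        ((v ⬝ᵥ x : ℝ) : ℂ) * Complex.I := by
      simp only [dotProduct, complexify, map_sum, map_mul, map_neg, Complex.conj_ofReal,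
        Complex.conj_I, Complex.ofReal_sum, Complex.ofReal_mul, Finset.sum_mul]
      exact Finset.sum_congr rfl fun i _ => by ring
    rw [e1, e2]
    ring
  rw [Lp.eq_zero_iff_ae_eq_zero]
  filter_upwards [hz] with x hx
  exact (mul_eq_zero.1 hx).resolve_left (Complex.exp_ne_zero _)

/-- Integration over pairs is integration over vectors indexed by the disjoint union. -/
theorem integral_sumElim {n : ℕ} (f : (Fin n ⊕ Fin n → ℝ) → ℂ) :
    ∫ z : (Fin n → ℝ) × (Fin n → ℝ), f (Sum.elim z.1 z.2) = ∫ u, f u := by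
  rw [← (volume_measurePreserving_sumPiEquivProdPi fun _ : Fin n ⊕ Fin n => ℝ).integral_comp'
    (fun z : (Fin n → ℝ) × (Fin n → ℝ) => f (Sum.elim z.1 z.2))]
  refine integral_congr_ae (ae_of_all _ fun u => ?_)
  simp only
  congr 1
  ext (i | i) <;> rfl

theorem complexify_sumElim {n : ℕ} (x y : Fin n → ℝ) :
    complexify (Sum.elim x y) = Sum.elim (complexify x) (complexify y) := by
  ext (i | i) <;> rfl

theorem l1norm_sum {n : ℕ} (x : Fin n ⊕ Fin n → ℝ) :
    l1norm x = l1norm (fun i => x (Sum.inl i)) + l1norm (fun i => x (Sum.inr i)) :=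
  Fintype.sum_sum_type _

theorem RapidOnTubes.tensor {n : ℕ} {f g : (Fin n → ℂ) → ℂ} (hf : RapidOnTubes f)
    (hg : RapidOnTubes g) : RapidOnTubes fun u : Fin n ⊕ Fin n → ℂ =>
      f (fun i => u (Sum.inl i)) * g (fun i => u (Sum.inr i)) := by
  refine ⟨(hf.differentiable.comp (by fun_prop)).mul (hg.differentiable.comp (by fun_prop)),
    fun R k => ?_⟩
  obtain ⟨C, hC, h⟩ := hf.bound |R| k
  obtain ⟨C', hC', h'⟩ := hg.bound |R| k
  refine ⟨C * C', by positivity, fun x w hw => ?_⟩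
  have hw' : ∀ i, ‖w i‖ ≤ |R| := fun i =>
    ((norm_le_pi_norm w i).trans hw).trans (le_abs_self R)
  rw [l1norm_sum, mul_add, Real.exp_add, mul_mul_mul_comm, norm_mul]
  have h1 := h (fun i => x (Sum.inl i)) (fun i => w (Sum.inl i))
    ((pi_norm_le_iff_of_nonneg (abs_nonneg R)).2 fun i => hw' _)
  have h2 := h' (fun i => x (Sum.inr i)) (fun i => w (Sum.inr i))
    ((pi_norm_le_iff_of_nonneg (abs_nonneg R)).2 fun i => hw' _)
  exact mul_le_mul h1 h2 (norm_nonneg _) ((norm_nonneg _).trans h1)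

/-! ### The complexified Gaussian -/

section

variable {n : ℕ}

/-- The complex bilinear form of a real matrix. -/
def complexForm (M : Matrix (Fin n) (Fin n) ℝ) (p q : Fin n → ℂ) : ℂ :=
  p ⬝ᵥ M.map (fun t : ℝ => (t : ℂ)) *ᵥ q

theorem complexForm_add_left (M : Matrix (Fin n) (Fin n) ℝ) (p p' q : Fin n → ℂ) :
    complexForm M (p + p') q = complexForm M p q + complexForm M p' q := add_dotProduct _ _ _

theorem complexForm_add_right (M : Matrix (Fin n) (Fin n) ℝ) (p q q' : Fin n → ℂ) :
    complexForm M p (q + q') = complexForm M p q + complexForm M p q' := by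
  simp [complexForm, Matrix.mulVec_add, dotProduct_add]

theorem complexForm_smul_left (M : Matrix (Fin n) (Fin n) ℝ) (c : ℂ) (p q : Fin n → ℂ) :
    complexForm M (c • p) q = c * complexForm M p q := smul_dotProduct _ _ _

theorem complexForm_smul_right (M : Matrix (Fin n) (Fin n) ℝ) (c : ℂ) (p q : Fin n → ℂ) :
    complexForm M p (c • q) = c * complexForm M p q := by
  simp [complexForm, Matrix.mulVec_smul, dotProduct_smul]

theorem complexForm_eq_sum (M : Matrix (Fin n) (Fin n) ℝ) (p q : Fin n → ℂ) :
    complexForm M p q = ∑ i, ∑ j, p i * ((M i j : ℂ) * q j) := by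
  simp [complexForm, dotProduct, Matrix.mulVec, Finset.mul_sum]

theorem complexForm_comm {M : Matrix (Fin n) (Fin n) ℝ} (hM : M.IsSymm) (p q : Fin n → ℂ) :
    complexForm M p q = complexForm M q p := by
  rw [complexForm_eq_sum, complexForm_eq_sum, Finset.sum_comm]
  refine Finset.sum_congr rfl fun i _ => Finset.sum_congr rfl fun j _ => ?_
  rw [hM.apply]
  ring

theorem complexForm_complexify (M : Matrix (Fin n) (Fin n) ℝ) (x y : Fin n → ℝ) :
    complexForm M (complexify x) (complexify y) = ((x ⬝ᵥ M *ᵥ y : ℝ) : ℂ) := by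
  rw [complexForm_eq_sum]
  simp [complexify, dotProduct, Matrix.mulVec, Finset.mul_sum]

theorem complexForm_complexify_right (M : Matrix (Fin n) (Fin n) ℝ) (p : Fin n → ℂ)
    (y : Fin n → ℝ) : complexForm M p (complexify y) = p ⬝ᵥ complexify (M *ᵥ y) := by
  rw [complexForm_eq_sum]
  simp [complexify, dotProduct, Matrix.mulVec, Finset.mul_sum]

theorem complexForm_complexify_left (M : Matrix (Fin n) (Fin n) ℝ) (x : Fin n → ℝ)
    (q : Fin n → ℂ) : complexForm M (complexify x) q = q ⬝ᵥ complexify (Mᵀ *ᵥ x) := by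
  rw [complexForm_eq_sum, Finset.sum_comm]
  simp only [complexify, dotProduct, Matrix.mulVec, Matrix.transpose_apply, Complex.ofReal_sum,
    Complex.ofReal_mul, Finset.mul_sum]
  exact Finset.sum_congr rfl fun i _ => Finset.sum_congr rfl fun j _ => by ring

theorem differentiable_complexForm (M : Matrix (Fin n) (Fin n) ℝ)
    {E : Type*} [NormedAddCommGroup E] [NormedSpace ℂ E] {f g : E → Fin n → ℂ}
    (hf : Differentiable ℂ f) (hg : Differentiable ℂ g) :
    Differentiable ℂ fun u => complexForm M (f u) (g u) := by
  simp only [complexForm_eq_sum]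
  fun_prop

theorem norm_complexForm_le (M : Matrix (Fin n) (Fin n) ℝ) (p q : Fin n → ℂ) :
    ‖complexForm M p q‖ ≤ (∑ i, ∑ j, |M i j|) * (∑ i, ‖p i‖) * ∑ i, ‖q i‖ := by
  rw [complexForm_eq_sum, Finset.sum_mul, Finset.sum_mul]
  refine (norm_sum_le _ _).trans (Finset.sum_le_sum fun i _ => ?_)
  rw [Finset.sum_mul, Finset.sum_mul]
  refine (norm_sum_le _ _).trans (Finset.sum_le_sum fun j _ => ?_)
  rw [norm_mul, norm_mul, Complex.norm_real, Real.norm_eq_abs]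
  have h1 : ‖p i‖ ≤ ∑ i, ‖p i‖ :=
    Finset.single_le_sum (f := fun i => ‖p i‖) (fun _ _ => norm_nonneg _) (Finset.mem_univ i)
  have h2 : ‖q j‖ ≤ ∑ i, ‖q i‖ :=
    Finset.single_le_sum (f := fun i => ‖q i‖) (fun _ _ => norm_nonneg _) (Finset.mem_univ j)
  calc ‖p i‖ * (|M i j| * ‖q j‖) = |M i j| * ‖p i‖ * ‖q j‖ := by ring
    _ ≤ _ := by gcongr

/-- The difference `x - y` of the two halves of a vector `(x, y)`. -/
def diffHalves (u : Fin n ⊕ Fin n → ℂ) : Fin n → ℂ := fun i => u (Sum.inl i) - u (Sum.inr i)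

/-- The sum `x + y` of the two halves of a vector `(x, y)`. -/
def sumHalves (u : Fin n ⊕ Fin n → ℂ) : Fin n → ℂ := fun i => u (Sum.inl i) + u (Sum.inr i)

theorem diffHalves_add (u v : Fin n ⊕ Fin n → ℂ) :
    diffHalves (u + v) = diffHalves u + diffHalves v := by
  ext i; simp only [diffHalves, Pi.add_apply]; ring

theorem sumHalves_add (u v : Fin n ⊕ Fin n → ℂ) :
    sumHalves (u + v) = sumHalves u + sumHalves v := by
  ext i; simp only [sumHalves, Pi.add_apply]; ring

theorem sum_norm_diffHalves_le (u : Fin n ⊕ Fin n → ℂ) :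
    ∑ i, ‖diffHalves u i‖ ≤ ∑ i, ‖u i‖ := by
  rw [Fintype.sum_sum_type, ← Finset.sum_add_distrib]
  exact Finset.sum_le_sum fun i _ => norm_sub_le _ _

theorem sum_norm_sumHalves_le (u : Fin n ⊕ Fin n → ℂ) :
    ∑ i, ‖sumHalves u i‖ ≤ ∑ i, ‖u i‖ := by
  rw [Fintype.sum_sum_type, ← Finset.sum_add_distrib]
  exact Finset.sum_le_sum fun i _ => norm_add_le _ _

/-- The exponent of the Gaussian kernel, as a quadratic polynomial on `ℂ²ⁿ`. -/
def gaussianExponent (A B C : Matrix (Fin n) (Fin n) ℝ) (u : Fin n ⊕ Fin n → ℂ) : ℂ :=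
  -complexForm A (diffHalves u) (diffHalves u)
    - Complex.I * complexForm B (diffHalves u) (sumHalves u)
    - complexForm C (sumHalves u) (sumHalves u)

theorem diffHalves_complexify (u : Fin n ⊕ Fin n → ℝ) :
    diffHalves (complexify u) = complexify fun i => u (Sum.inl i) - u (Sum.inr i) := by
  ext i; simp [diffHalves, complexify]

theorem sumHalves_complexify (u : Fin n ⊕ Fin n → ℝ) :
    sumHalves (complexify u) = complexify fun i => u (Sum.inl i) + u (Sum.inr i) := by
  ext i; simp [sumHalves, complexify]

theorem gaussianKernel_eq (A B C : Matrix (Fin n) (Fin n) ℝ) (x y : Fin n → ℝ) :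
    gaussianKernel A B C x y =
      Complex.exp (gaussianExponent A B C (complexify (Sum.elim x y))) := by
  rw [gaussianExponent, diffHalves_complexify, sumHalves_complexify]
  simp only [complexForm_complexify]
  rfl

theorem differentiable_gaussianExponent (A B C : Matrix (Fin n) (Fin n) ℝ) :
    Differentiable ℂ (gaussianExponent A B C) := by
  have h1 : Differentiable ℂ (diffHalves (n := n)) := by unfold diffHalves; fun_prop
  have h2 : Differentiable ℂ (sumHalves (n := n)) := by unfold sumHalves; fun_prop
  exact ((differentiable_complexForm A h1 h1).neg.sub
    ((differentiable_complexForm B h1 h2).const_mul Complex.I)).sub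
    (differentiable_complexForm C h2 h2)

/-- On a tube the real part of the exponent is at most linear in the real direction, because its
quadratic part is nonpositive there. -/
theorem moderate_gaussian {A B C : Matrix (Fin n) (Fin n) ℝ}
    (hA : ∀ x, 0 ≤ x ⬝ᵥ A *ᵥ x) (hC : ∀ x, 0 ≤ x ⬝ᵥ C *ᵥ x) :
    ModerateOnTubes fun u => Complex.exp (gaussianExponent A B C u) := by
  refine ⟨(differentiable_gaussianExponent A B C).cexp, fun R => ?_⟩
  set m : Matrix (Fin n) (Fin n) ℝ → ℝ := fun M => ∑ i, ∑ j, |M i j| with hm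
  have hm0 : ∀ M, 0 ≤ m M := fun M =>
    Finset.sum_nonneg fun _ _ => Finset.sum_nonneg fun _ _ => abs_nonneg _
  set W : ℝ := Fintype.card (Fin n ⊕ Fin n) * |R| with hW
  have hW0 : 0 ≤ W := by positivity
  have hmA := hm0 A
  have hmB := hm0 B
  have hmC := hm0 C
  refine ⟨Real.exp ((m A + m B + m C) * W * W), 2 * (m A + m B + m C) * W, by positivity,
    by positivity, fun x w hw => ?_⟩
  rw [Complex.norm_exp, ← Real.exp_add]
  gcongr
  have hw1 : ∑ i, ‖w i‖ ≤ W := by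
    calc ∑ i, ‖w i‖ ≤ ∑ _i : Fin n ⊕ Fin n, |R| := Finset.sum_le_sum fun i _ =>
          ((norm_le_pi_norm w i).trans hw).trans (le_abs_self R)
      _ = W := by simp [hW]
  have hx1 : ∑ i, ‖complexify x i‖ = l1norm x := by simp [complexify, l1norm]
  have hx0 := l1norm_nonneg x
  have hb : ∀ (M : Matrix (Fin n) (Fin n) ℝ) (p q : Fin n → ℂ) (a b : ℝ), 0 ≤ a →
      ∑ i, ‖p i‖ ≤ a → ∑ i, ‖q i‖ ≤ b → ‖complexForm M p q‖ ≤ m M * a * b := by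
    intro M p q a b ha hp hq
    refine (norm_complexForm_le M p q).trans ?_
    have := hm0 M
    have : 0 ≤ ∑ i, ‖q i‖ := Finset.sum_nonneg fun _ _ => norm_nonneg _
    gcongr
  have hdx : ∑ i, ‖diffHalves (complexify x) i‖ ≤ l1norm x :=
    (sum_norm_diffHalves_le _).trans hx1.le
  have hsx : ∑ i, ‖sumHalves (complexify x) i‖ ≤ l1norm x :=
    (sum_norm_sumHalves_le _).trans hx1.le
  have hdw : ∑ i, ‖diffHalves w i‖ ≤ W := (sum_norm_diffHalves_le _).trans hw1
  have hsw : ∑ i, ‖sumHalves w i‖ ≤ W := (sum_norm_sumHalves_le _).trans hw1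
  have hre : ∀ z : ℂ, (-z).re ≤ ‖z‖ := fun z => by
    rw [← norm_neg]; exact Complex.re_le_norm _
  have hreI : ∀ z : ℂ, (-(Complex.I * z)).re ≤ ‖z‖ := fun z => by
    refine (hre _).trans (by simp)
  have hself : (gaussianExponent A B C (complexify x)).re ≤ 0 := by
    rw [gaussianExponent, diffHalves_complexify, sumHalves_complexify]
    simp only [complexForm_complexify, Complex.sub_re, Complex.neg_re, Complex.ofReal_re,
      Complex.mul_re, Complex.I_re, Complex.I_im, Complex.ofReal_im]
    linarith [hA fun i => x (Sum.inl i) - x (Sum.inr i),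
      hC fun i => x (Sum.inl i) + x (Sum.inr i)]
  have hexpand : gaussianExponent A B C (complexify x + w) =
      gaussianExponent A B C (complexify x)
      + -complexForm A (diffHalves (complexify x)) (diffHalves w)
      + -complexForm A (diffHalves w) (diffHalves (complexify x))
      + -complexForm A (diffHalves w) (diffHalves w)
      + -(Complex.I * complexForm B (diffHalves (complexify x)) (sumHalves w))
      + -(Complex.I * complexForm B (diffHalves w) (sumHalves (complexify x)))
      + -(Complex.I * complexForm B (diffHalves w) (sumHalves w))
      + -complexForm C (sumHalves (complexify x)) (sumHalves w)
      + -complexForm C (sumHalves w) (sumHalves (complexify x))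
      + -complexForm C (sumHalves w) (sumHalves w) := by
    simp only [gaussianExponent, diffHalves_add, sumHalves_add, complexForm_add_left,
      complexForm_add_right]
    ring
  rw [hexpand]
  simp only [Complex.add_re]
  have i1 := (hre _).trans (hb A _ _ _ _ hx0 hdx hdw)
  have i2 := (hre _).trans (hb A _ _ _ _ hW0 hdw hdx)
  have i3 := (hre _).trans (hb A _ _ _ _ hW0 hdw hdw)
  have i4 := (hreI _).trans (hb B _ _ _ _ hx0 hdx hsw)
  have i5 := (hreI _).trans (hb B _ _ _ _ hW0 hdw hsx)
  have i6 := (hreI _).trans (hb B _ _ _ _ hW0 hdw hsw)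
  have i7 := (hre _).trans (hb C _ _ _ _ hx0 hsx hsw)
  have i8 := (hre _).trans (hb C _ _ _ _ hW0 hsw hsx)
  have i9 := (hre _).trans (hb C _ _ _ _ hW0 hsw hsw)
  nlinarith

/-- The vector `(conj a, a)`. -/
def conjPair (a : Fin n → ℂ) : Fin n ⊕ Fin n → ℂ := Sum.elim (fun i => conj (a i)) a

/-- The linear form by which a Gaussian changes under the translation by `(conj a, a)`. -/
def shiftForm (A B C : Matrix (Fin n) (Fin n) ℝ) (a : Fin n → ℂ) : Fin n → ℂ := fun i =>
  ((-2 * (Bᵀ *ᵥ fun j => (a j).im) i - 4 * (C *ᵥ fun j => (a j).re) i : ℝ) : ℂ) -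
    Complex.I * ((4 * (A *ᵥ fun j => (a j).im) i - 2 * (B *ᵥ fun j => (a j).re) i : ℝ) : ℂ)

/-- A Gaussian translated by `(conj a, a)` is the Gaussian times a positive constant and a factor
`conj (h x) * h y`. -/
theorem gaussianExponent_add_conjPair {A C : Matrix (Fin n) (Fin n) ℝ} (hA : A.IsSymm)
    (hC : C.IsSymm) (B : Matrix (Fin n) (Fin n) ℝ) (a : Fin n → ℂ) :
    ∃ c : ℝ, ∀ u : Fin n ⊕ Fin n → ℂ, gaussianExponent A B C (u + conjPair a) =
      gaussianExponent A B C u + (fun i => conj (shiftForm A B C a i)) ⬝ᵥ (fun i => u (Sum.inl i))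
        + shiftForm A B C a ⬝ᵥ (fun i => u (Sum.inr i)) + (c : ℂ) := by
  set r : Fin n → ℝ := fun j => (a j).re with hr
  set b : Fin n → ℝ := fun j => (a j).im with hb
  refine ⟨4 * (b ⬝ᵥ A *ᵥ b) - 4 * (b ⬝ᵥ B *ᵥ r) - 4 * (r ⬝ᵥ C *ᵥ r), fun u => ?_⟩
  have hd : diffHalves (conjPair a) = (-2 * Complex.I) • complexify b := by
    ext i
    apply Complex.ext <;> simp [diffHalves, conjPair, complexify, hb]
    ring
  have hs : sumHalves (conjPair a) = (2 : ℂ) • complexify r := by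
    ext i
    apply Complex.ext <;> simp [sumHalves, conjPair, complexify, hr]
    ring
  have hlin : (fun i => conj (shiftForm A B C a i)) ⬝ᵥ (fun i => u (Sum.inl i))
        + shiftForm A B C a ⬝ᵥ (fun i => u (Sum.inr i)) =
      -2 * (sumHalves u ⬝ᵥ complexify (Bᵀ *ᵥ b)) - 4 * (sumHalves u ⬝ᵥ complexify (C *ᵥ r))
      + Complex.I * (4 * (diffHalves u ⬝ᵥ complexify (A *ᵥ b))
        - 2 * (diffHalves u ⬝ᵥ complexify (B *ᵥ r))) := by
    simp only [dotProduct, Finset.mul_sum, ← Finset.sum_add_distrib, ← Finset.sum_sub_distrib]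
    refine Finset.sum_congr rfl fun i _ => ?_
    simp only [shiftForm, sumHalves, diffHalves, complexify, map_sub, map_mul,
      Complex.conj_ofReal, Complex.conj_I, ← hr, ← hb]
    push_cast
    ring
  rw [add_assoc (gaussianExponent A B C u), hlin]
  simp only [gaussianExponent, diffHalves_add, sumHalves_add, hd, hs, complexForm_add_left,
    complexForm_add_right, complexForm_smul_left, complexForm_smul_right]
  rw [complexForm_comm hA (complexify b) (diffHalves u),
    complexForm_comm hC (complexify r) (sumHalves u)]
  simp only [complexForm_complexify]
  simp only [complexForm_complexify_right, complexForm_complexify_left]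
  push_cast
  linear_combination (4 * ((b ⬝ᵥ B *ᵥ r : ℝ) : ℂ) + 2 * (sumHalves u ⬝ᵥ complexify (Bᵀ *ᵥ b))
    - 4 * ((b ⬝ᵥ A *ᵥ b : ℝ) : ℂ)) * Complex.I_sq

end

/-! ### Positivity passes from a polynomial multiple of a Gaussian to the Gaussian -/

section

variable {n : ℕ}

theorem conjPair_smul (t : ℝ) (a : Fin n → ℂ) :
    conjPair ((t : ℂ) • a) = (t : ℂ) • conjPair a := by
  ext (i | i) <;> simp [conjPair]

theorem nonneg_of_pos_mul_nonneg {z w : ℂ} (hz : 0 < z) (h : 0 ≤ z * w) : 0 ≤ w := by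
  have h1 := mul_nonneg (inv_nonneg.2 hz.le) h
  rwa [inv_mul_cancel_left₀ hz.ne'] at h1

/-- Testing a positive operator with kernel `p G`, `G` Gaussian, on translates of `g` by complex
vectors `a` shows that the translated polynomial again gives a nonnegative quadratic form. -/
theorem integral_translate_nonneg {A B C : Matrix (Fin n) (Fin n) ℝ} (hA : A.IsSymm)
    (hC : C.IsSymm) (hA0 : ∀ x, 0 ≤ x ⬝ᵥ A *ᵥ x) (hC0 : ∀ x, 0 ≤ x ⬝ᵥ C *ᵥ x)
    {p : MvPolynomial (Fin n ⊕ Fin n) ℂ} {T : L2 n →L[ℂ] L2 n}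
    (hT : IsIntegralOperator (fun x y => polyVal p x y * gaussianKernel A B C x y) T)
    (hpos : T.IsPositive) {g : (Fin n → ℂ) → ℂ} (hg : RapidOnTubes g) (a : Fin n → ℂ) :
    0 ≤ ∫ u : Fin n ⊕ Fin n → ℝ,
      conj (g (complexify fun i => u (Sum.inl i))) * g (complexify fun i => u (Sum.inr i)) *
        Complex.exp (gaussianExponent A B C (complexify u)) *
        MvPolynomial.eval (complexify u + conjPair a) p := by
  obtain ⟨c, hc⟩ := gaussianExponent_add_conjPair hA hC B a
  set lam := shiftForm A B C a with hlam
  -- The exponential factor compensates the linear terms that the translation produces.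
  have hf : RapidOnTubes fun v : Fin n → ℂ => g (v + -a) * Complex.exp ((-lam) ⬝ᵥ (v + -a)) :=
    (hg.mul_moderate (ModerateOnTubes.exp_linear (-lam))).comp_add (-a)
  set f : (Fin n → ℂ) → ℂ := fun v => g (v + -a) * Complex.exp ((-lam) ⬝ᵥ (v + -a)) with hfdef
  have hF : RapidOnTubes fun u : Fin n ⊕ Fin n → ℂ =>
      (conj (f fun i => conj (u (Sum.inl i))) * f (fun i => u (Sum.inr i))) *
        Complex.exp (gaussianExponent A B C u) * MvPolynomial.eval u p :=
    ((hf.conj_conj.tensor hf).mul_moderate (moderate_gaussian hA0 hC0)).mul_moderate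
      (ModerateOnTubes.eval p)
  have hnonneg := hpos.inner_nonneg_right (hf.memLp.toLp _)
  rw [hT.inner_apply hf.memLp hf.memLp] at hnonneg
  have hint : ∫ z : (Fin n → ℝ) × (Fin n → ℝ), conj (f (complexify z.1)) *
      (polyVal p z.1 z.2 * gaussianKernel A B C z.1 z.2 * f (complexify z.2)) =
      Complex.exp c * ∫ u : Fin n ⊕ Fin n → ℝ,
      conj (g (complexify fun i => u (Sum.inl i))) * g (complexify fun i => u (Sum.inr i)) *
        Complex.exp (gaussianExponent A B C (complexify u)) *
        MvPolynomial.eval (complexify u + conjPair a) p := by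
    have h1 := hF.integral_add_eq (conjPair a)
    rw [← integral_sumElim (fun u => (fun u : Fin n ⊕ Fin n → ℂ =>
      (conj (f fun i => conj (u (Sum.inl i))) * f (fun i => u (Sum.inr i))) *
        Complex.exp (gaussianExponent A B C u) * MvPolynomial.eval u p) (complexify u))] at h1
    rw [← integral_const_mul]
    refine Eq.trans ?_ (h1.symm.trans ?_)
    · refine integral_congr_ae (ae_of_all _ fun z => ?_)
      simp only
      have e1 : (fun i => conj (complexify (Sum.elim z.1 z.2) (Sum.inl i))) = complexify z.1 := by
        ext i; simp [complexify]
      have e2 : (fun i => complexify (Sum.elim z.1 z.2) (Sum.inr i)) = complexify z.2 := by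
        ext i; simp [complexify]
      have e3 : polyVal p z.1 z.2 = MvPolynomial.eval (complexify (Sum.elim z.1 z.2)) p := by
        rw [complexify_sumElim]; rfl
      rw [e1, e2, e3, gaussianKernel_eq]
      ring
    · refine integral_congr_ae (ae_of_all _ fun u => ?_)
      simp only
      have e1 : (fun i => conj ((complexify u + conjPair a) (Sum.inl i))) + -a =
          complexify fun i => u (Sum.inl i) := by
        ext i; simp [complexify, conjPair]
      have e2 : (fun i => (complexify u + conjPair a) (Sum.inr i)) + -a =
          complexify fun i => u (Sum.inr i) := by
        ext i; simp [complexify, conjPair]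
      have e4 : conj ((-lam) ⬝ᵥ complexify fun i => u (Sum.inl i)) =
          -((fun i => conj (lam i)) ⬝ᵥ fun i => complexify u (Sum.inl i)) := by
        simp [dotProduct, complexify]
      have e5 : (-lam) ⬝ᵥ (complexify fun i => u (Sum.inr i)) =
          -(lam ⬝ᵥ fun i => complexify u (Sum.inr i)) := by
        simp [dotProduct, complexify]
      simp only [hfdef, e1, e2, hc, map_mul, ← Complex.exp_conj, e4, e5, Complex.exp_add,
        Complex.exp_neg]
      field_simp
  rw [hint] at hnonneg
  have hcpos : (0 : ℂ) < Complex.exp c := by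
    rw [← Complex.ofReal_exp]
    exact_mod_cast Real.exp_pos c
  exact nonneg_of_pos_mul_nonneg hcpos hnonneg

theorem eval_smul_of_isHomogeneous {σ : Type*} {p : MvPolynomial σ ℂ} {d : ℕ}
    (hp : p.IsHomogeneous d) (t : ℂ) (w : σ → ℂ) :
    MvPolynomial.eval (t • w) p = t ^ d * MvPolynomial.eval w p := by
  rw [MvPolynomial.eval_eq, MvPolynomial.eval_eq, Finset.mul_sum]
  refine Finset.sum_congr rfl fun m hm => ?_
  have hd : ∑ i ∈ m.support, m i = d := by
    simpa [Finsupp.weight_apply, Finsupp.sum] using hp (MvPolynomial.mem_support_iff.1 hm)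
  simp only [Pi.smul_apply, smul_eq_mul, mul_pow, Finset.prod_mul_distrib,
    Finset.prod_pow_eq_pow_sum, hd]
  ring

/-- The polynomial `p (w + s / τ)`, multiplied by the power of `τ` that makes it regular at
`τ = 0`. -/
noncomputable def rescaledEval {σ : Type*} (p : MvPolynomial σ ℂ) (s : σ → ℂ) (τ : ℂ)
    (w : σ → ℂ) : ℂ :=
  ∑ j ∈ Finset.range (p.totalDegree + 1), τ ^ (p.totalDegree - j) *
    MvPolynomial.eval (τ • w + s) (MvPolynomial.homogeneousComponent j p)

theorem rescaledEval_zero {σ : Type*} (p : MvPolynomial σ ℂ) (s w : σ → ℂ) :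
    rescaledEval p s 0 w =
      MvPolynomial.eval s (MvPolynomial.homogeneousComponent p.totalDegree p) := by
  rw [rescaledEval, Finset.sum_eq_single_of_mem p.totalDegree (Finset.self_mem_range_succ _)]
  · simp
  · intro j hj hne
    have : p.totalDegree - j ≠ 0 := by
      have := Finset.mem_range.1 hj
      omega
    simp [this]

theorem eval_add_smul_eq {σ : Type*} (p : MvPolynomial σ ℂ) (s w : σ → ℂ) {t : ℂ} (ht : t ≠ 0) :
    MvPolynomial.eval (w + t • s) p = t ^ p.totalDegree * rescaledEval p s t⁻¹ w := by
  conv_lhs => rw [← MvPolynomial.sum_homogeneousComponent p]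
  rw [map_sum, rescaledEval, Finset.mul_sum]
  refine Finset.sum_congr rfl fun j hj => ?_
  have h1 : w + t • s = t • (t⁻¹ • w + s) := by
    rw [smul_add, smul_inv_smul₀ ht]
  rw [h1, eval_smul_of_isHomogeneous (MvPolynomial.homogeneousComponent_isHomogeneous j p),
    ← mul_assoc]
  congr 1
  have hj' : j ≤ p.totalDegree := by
    have := Finset.mem_range.1 hj
    omega
  rw [inv_pow, ← div_eq_mul_inv, eq_div_iff (pow_ne_zero _ ht), ← pow_add,
    Nat.add_sub_cancel' hj']

theorem continuous_rescaledEval {σ : Type*} (p : MvPolynomial σ ℂ) (s w : σ → ℂ) :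
    Continuous fun τ : ℂ => rescaledEval p s τ w := by
  unfold rescaledEval
  refine continuous_finsetSum _ fun j _ => (continuous_pow _).mul ?_
  exact (MvPolynomial.continuous_eval _).comp (by fun_prop)

/-- A bound for the rescaled polynomials that is uniform in `τ ∈ [0, 1]`. -/
theorem norm_rescaledEval_le {σ : Type*} [Fintype σ] (p : MvPolynomial σ ℂ) (s : σ → ℂ) :
    ∃ C k : ℝ, ∀ τ : ℝ, 0 ≤ τ → τ ≤ 1 → ∀ x : σ → ℝ,
      ‖rescaledEval p s (τ : ℂ) (complexify x)‖ ≤ C * Real.exp (k * l1norm x) := by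
  choose C k hC hk h using fun j => (ModerateOnTubes.eval
    (MvPolynomial.homogeneousComponent j p)).bound ‖s‖
  refine ⟨∑ j ∈ Finset.range (p.totalDegree + 1), C j,
    ∑ j ∈ Finset.range (p.totalDegree + 1), k j, fun τ h0 h1 x => ?_⟩
  rw [rescaledEval, Finset.sum_mul]
  refine (norm_sum_le _ _).trans (Finset.sum_le_sum fun j hj => ?_)
  have hx : (τ : ℂ) • complexify x = complexify (τ • x) := by
    ext i; simp [complexify]
  have hl : l1norm (τ • x) = τ * l1norm x := by
    simp [l1norm, abs_mul, abs_of_nonneg h0, Finset.mul_sum]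
  have hkj : k j ≤ ∑ j ∈ Finset.range (p.totalDegree + 1), k j :=
    Finset.single_le_sum (fun i _ => hk i) hj
  have hlx := l1norm_nonneg x
  rw [norm_mul, norm_pow, Complex.norm_real, Real.norm_of_nonneg h0, hx]
  calc τ ^ (p.totalDegree - j) * _ ≤ 1 * (C j * Real.exp (k j * l1norm (τ • x))) :=
        mul_le_mul (pow_le_one₀ h0 h1) (h j _ s le_rfl) (norm_nonneg _) zero_le_one
    _ ≤ _ := by
      rw [one_mul, hl]
      have := hC j
      have := hk j
      have := (hk j).trans hkj
      gcongr
      exact mul_le_of_le_one_left hlx h1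

/-- The leading form of `p` at `(conj a, a)` times the quadratic form of the Gaussian is
nonnegative. -/
theorem leadingForm_mul_integral_nonneg {A B C : Matrix (Fin n) (Fin n) ℝ} (hA : A.IsSymm)
    (hC : C.IsSymm) (hA0 : ∀ x, 0 ≤ x ⬝ᵥ A *ᵥ x) (hC0 : ∀ x, 0 ≤ x ⬝ᵥ C *ᵥ x)
    {p : MvPolynomial (Fin n ⊕ Fin n) ℂ} {T : L2 n →L[ℂ] L2 n}
    (hT : IsIntegralOperator (fun x y => polyVal p x y * gaussianKernel A B C x y) T)
    (hpos : T.IsPositive) {g : (Fin n → ℂ) → ℂ} (hg : RapidOnTubes g) (a : Fin n → ℂ) :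
    0 ≤ MvPolynomial.eval (conjPair a) (MvPolynomial.homogeneousComponent p.totalDegree p) *
      ∫ u : Fin n ⊕ Fin n → ℝ,
      conj (g (complexify fun i => u (Sum.inl i))) * g (complexify fun i => u (Sum.inr i)) *
        Complex.exp (gaussianExponent A B C (complexify u)) := by
  set K : (Fin n ⊕ Fin n → ℝ) → ℂ := fun u =>
    conj (g (complexify fun i => u (Sum.inl i))) * g (complexify fun i => u (Sum.inr i)) *
        Complex.exp (gaussianExponent A B C (complexify u)) with hK
  have hR : RapidOnTubes fun u : Fin n ⊕ Fin n → ℂ =>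
      (conj (g fun i => conj (u (Sum.inl i))) * g (fun i => u (Sum.inr i))) *
        Complex.exp (gaussianExponent A B C u) :=
    (hg.conj_conj.tensor hg).mul_moderate (moderate_gaussian hA0 hC0)
  have hRK : ∀ u : Fin n ⊕ Fin n → ℝ, (fun u : Fin n ⊕ Fin n → ℂ =>
      (conj (g fun i => conj (u (Sum.inl i))) * g (fun i => u (Sum.inr i))) *
        Complex.exp (gaussianExponent A B C u)) (complexify u) = K u := by
    intro u
    have e1 : (fun i => conj (complexify u (Sum.inl i))) = complexify fun i => u (Sum.inl i) := by
      ext i; simp [complexify]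
    simp only [hK, e1]
    rfl
  have hKm : AEStronglyMeasurable K volume :=
    hR.integrable.1.congr (ae_of_all _ hRK)
  obtain ⟨c, k, hck⟩ := norm_rescaledEval_le p (conjPair a)
  obtain ⟨D, hD, hDb⟩ := hR.bound 0 (k + 1)
  have hKb : ∀ u, ‖K u‖ ≤ D * Real.exp (-(k + 1) * l1norm u) := fun u => by
    have := hDb u 0 (by simp)
    have e := hRK u
    beta_reduce at e
    rwa [add_zero, e] at this
  have hτ : ∀ m : ℕ, 0 ≤ 1 / ((m : ℝ) + 1) ∧ 1 / ((m : ℝ) + 1) ≤ 1 := fun m => by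
    refine ⟨by positivity, ?_⟩
    rw [div_le_one (by positivity)]
    linarith [(Nat.cast_nonneg m : (0 : ℝ) ≤ m)]
  -- The translations are by the multiples `m + 1` of `a`, that is, `τ = 1 / (m + 1)`.
  have hlim : Tendsto (fun m : ℕ => ∫ u, K u *
      rescaledEval p (conjPair a) ((1 / ((m : ℝ) + 1) : ℝ) : ℂ) (complexify u)) atTop
      (𝓝 (∫ u, K u *
        MvPolynomial.eval (conjPair a) (MvPolynomial.homogeneousComponent p.totalDegree p))) := by
    refine tendsto_integral_of_dominated_convergence
      (fun u => D * c * Real.exp (-l1norm u)) (fun m => ?_)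
      (integrable_exp_neg_l1norm.const_mul _) (fun m => ae_of_all _ fun u => ?_)
      (ae_of_all _ fun u => ?_)
    · refine hKm.mul (Continuous.aestronglyMeasurable ?_)
      unfold rescaledEval
      refine continuous_finsetSum _ fun j _ => continuous_const.mul ?_
      refine (MvPolynomial.continuous_eval _).comp ?_
      exact Continuous.add (continuous_complexify.const_smul (_ : ℂ)) continuous_const
    · have h1 := hck _ (hτ m).1 (hτ m).2 u
      have e : -l1norm u = -(k + 1) * l1norm u + k * l1norm u := by ring
      rw [norm_mul, e, Real.exp_add, mul_mul_mul_comm]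
      exact mul_le_mul (hKb u) h1 (norm_nonneg _) ((norm_nonneg _).trans (hKb u))
    · rw [← rescaledEval_zero p (conjPair a) (complexify u)]
      refine Tendsto.const_mul _ ?_
      exact ((continuous_rescaledEval p (conjPair a) (complexify u)).tendsto 0).comp
        (tendsto_nhdsWithin_iff.1 tendsto_one_div_nhdsNE).1
  rw [integral_mul_const, mul_comm] at hlim
  have : OrderClosedTopology ℂ := Complex.orderClosedTopology
  refine ge_of_tendsto' hlim fun m => ?_
  have h := integral_translate_nonneg hA hC hA0 hC0 hT hpos hg (((m + 1 : ℝ) : ℂ) • a)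
  have hm0 : ((m + 1 : ℝ) : ℂ) ≠ 0 := by exact_mod_cast (by positivity : (m + 1 : ℝ) ≠ 0)
  simp_rw [conjPair_smul, eval_add_smul_eq p (conjPair a) _ hm0] at h
  have h2 : ∫ u, K u * rescaledEval p (conjPair a) ((1 / ((m : ℝ) + 1) : ℝ) : ℂ) (complexify u) =
      (((m + 1 : ℝ) : ℂ) ^ p.totalDegree)⁻¹ * ∫ u, K u * (((m + 1 : ℝ) : ℂ) ^ p.totalDegree *
        rescaledEval p (conjPair a) ((m + 1 : ℝ) : ℂ)⁻¹ (complexify u)) := by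
    rw [← integral_const_mul]
    refine integral_congr_ae (ae_of_all _ fun u => ?_)
    have e : ((1 / ((m : ℝ) + 1) : ℝ) : ℂ) = ((m + 1 : ℝ) : ℂ)⁻¹ := by push_cast; simp
    simp only [e]
    field_simp
  rw [h2]
  refine mul_nonneg ?_ h
  rw [← Complex.ofReal_pow, ← Complex.ofReal_inv]
  exact_mod_cast (by positivity : (0 : ℝ) ≤ ((m + 1 : ℝ) ^ p.totalDegree)⁻¹)

/-- A nonzero polynomial on `ℂ²ⁿ` does not vanish on all the vectors `(conj a, a)`, which form
a totally real subspace of full dimension. -/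
theorem exists_eval_conjPair_ne_zero {p : MvPolynomial (Fin n ⊕ Fin n) ℂ} (hp : p ≠ 0) :
    ∃ a : Fin n → ℂ, MvPolynomial.eval (conjPair a) p ≠ 0 := by
  by_contra! h
  -- In the coordinates `v + I w`, `v - I w` the subspace is the set of real points.
  let s : Fin n ⊕ Fin n → MvPolynomial (Fin n ⊕ Fin n) ℂ :=
    Sum.elim (fun i => MvPolynomial.X (Sum.inl i) - MvPolynomial.C Complex.I *
        MvPolynomial.X (Sum.inr i))
      (fun i => MvPolynomial.X (Sum.inl i) + MvPolynomial.C Complex.I *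
        MvPolynomial.X (Sum.inr i))
  have heval : ∀ v : Fin n ⊕ Fin n → ℂ, MvPolynomial.eval v (MvPolynomial.bind₁ s p) =
      MvPolynomial.eval (fun i => MvPolynomial.eval v (s i)) p := fun v =>
    MvPolynomial.eval₂Hom_bind₁ _ _ _ _
  have hq : MvPolynomial.bind₁ s p = 0 := by
    refine MvPolynomial.funext_set (fun _ => Set.range ((↑) : ℝ → ℂ))
      (fun _ => Set.infinite_range_of_injective Complex.ofReal_injective) fun v hv => ?_
    choose r hr using fun i => hv i (Set.mem_univ i)
    rw [heval, map_zero, ← h fun i => (r (Sum.inl i) : ℂ) + Complex.I * r (Sum.inr i)]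
    congr 2
    ext (i | i) <;> simp [s, conjPair, ← hr, sub_eq_add_neg]
  refine hp (MvPolynomial.funext fun u => ?_)
  have h1 := heval (Sum.elim (fun i => (u (Sum.inl i) + u (Sum.inr i)) / 2)
    (fun i => (u (Sum.inr i) - u (Sum.inl i)) / (2 * Complex.I)))
  rw [hq, map_zero] at h1
  rw [map_zero, h1]
  congr 2
  ext (i | i)
  · simp only [s, Sum.elim_inl, Sum.elim_inr, map_sub, map_mul, MvPolynomial.eval_X,
      MvPolynomial.eval_C]
    field_simp
    ring
  · simp only [s, Sum.elim_inl, Sum.elim_inr, map_add, map_mul, MvPolynomial.eval_X,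
      MvPolynomial.eval_C]
    field_simp
    ring

theorem homogeneousComponent_totalDegree_ne_zero {σ : Type*} {p : MvPolynomial σ ℂ}
    (hp : p ≠ 0) : MvPolynomial.homogeneousComponent p.totalDegree p ≠ 0 := by
  obtain ⟨m, hm, hd⟩ := Finset.exists_mem_eq_sup p.support
    (MvPolynomial.support_nonempty.2 hp) fun m => m.sum fun _ e => e
  intro h
  have h1 := congrArg (MvPolynomial.coeff m) h
  rw [MvPolynomial.coeff_homogeneousComponent, MvPolynomial.totalDegree, hd,
    if_pos (by simp [Finsupp.degree_apply, Finsupp.sum]),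
    MvPolynomial.coeff_zero] at h1
  exact MvPolynomial.mem_support_iff.1 hm h1

theorem continuous_gaussianKernel (A B C : Matrix (Fin n) (Fin n) ℝ) :
    Continuous fun z : (Fin n → ℝ) × (Fin n → ℝ) => gaussianKernel A B C z.1 z.2 := by
  simp only [gaussianKernel_eq]
  refine ((differentiable_gaussianExponent A B C).continuous.comp
    (continuous_complexify.comp ?_)).cexp
  refine continuous_pi fun i => ?_
  rcases i with i | i <;> simp only [Sum.elim_inl, Sum.elim_inr] <;> fun_prop

/-- If the product of a nonzero polynomial and a Gaussian is the kernel of a positive operator,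
then so is the Gaussian. -/
theorem isPositive_of_isPositive_polynomial_mul {A B C : Matrix (Fin n) (Fin n) ℝ}
    (hA : A.IsSymm) (hC : C.IsSymm) (hA0 : ∀ x, 0 ≤ x ⬝ᵥ A *ᵥ x) (hC0 : ∀ x, 0 ≤ x ⬝ᵥ C *ᵥ x)
    {p : MvPolynomial (Fin n ⊕ Fin n) ℂ} (hp : p ≠ 0) {T : L2 n →L[ℂ] L2 n}
    (hT : IsIntegralOperator (fun x y => polyVal p x y * gaussianKernel A B C x y) T)
    (hpos : T.IsPositive) {G : L2 n →L[ℂ] L2 n}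
    (hG : IsIntegralOperator (gaussianKernel A B C) G) : G.IsPositive := by
  have : OrderClosedTopology ℂ := Complex.orderClosedTopology
  obtain ⟨a, ha⟩ := exists_eval_conjPair_ne_zero (homogeneousComponent_totalDegree_ne_zero hp)
  set π := MvPolynomial.eval (conjPair a) (MvPolynomial.homogeneousComponent p.totalDegree p)
  have hrapid : ∀ f ∈ rapidSubmodule n, 0 ≤ π * ⟪f, G f⟫_ℂ := by
    rintro f ⟨g, hg, hfg⟩
    have h := leadingForm_mul_integral_nonneg hA hC hA0 hC0 hT hpos hg a
    have hf : f = hg.memLp.toLp _ := by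
      refine Lp.ext ?_
      filter_upwards [hfg, hg.memLp.coeFn_toLp] with x h1 h2
      rw [h1, h2]
    rw [hf, hG.inner_apply hg.memLp hg.memLp]
    rw [← integral_sumElim (fun u : Fin n ⊕ Fin n → ℝ =>
      conj (g (complexify fun i => u (Sum.inl i))) * g (complexify fun i => u (Sum.inr i)) *
        Complex.exp (gaussianExponent A B C (complexify u)))] at h
    refine h.trans (le_of_eq ?_)
    congr 1
    refine integral_congr_ae (ae_of_all _ fun z => ?_)
    simp only [Sum.elim_inl, Sum.elim_inr, gaussianKernel_eq]
    ring
  have hall : ∀ f : L2 n, 0 ≤ π * ⟪f, G f⟫_ℂ := by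
    have hclosed : IsClosed {f : L2 n | 0 ≤ π * ⟪f, G f⟫_ℂ} :=
      isClosed_le continuous_const
        (continuous_const.mul (continuous_id.inner G.continuous))
    intro f
    exact hclosed.closure_subset_iff.2 hrapid (dense_rapidSubmodule n f)
  -- The sign of `π` is found by testing against approximations of the delta function at `0`.
  have hπ0 : 0 ≤ π := by
    have h1 := (tendsto_inner_ballDensity hG (continuous_gaussianKernel A B C) 0).const_mul π
    have h2 : gaussianKernel A B C 0 0 = 1 := by simp [gaussianKernel]
    rw [h2, mul_one] at h1
    exact ge_of_tendsto' h1 fun r => hall _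
  have hπ : 0 < π := lt_of_le_of_ne hπ0 (Ne.symm ha)
  have hnn : ∀ f : L2 n, 0 ≤ ⟪f, G f⟫_ℂ := fun f =>
    nonneg_of_pos_mul_nonneg hπ (hall f)
  rw [ContinuousLinearMap.isPositive_iff_complex]
  intro f
  have h := hnn f
  rw [← inner_conj_symm, Complex.le_def] at h
  simp only [Complex.zero_re, Complex.zero_im, Complex.conj_re, Complex.conj_im] at h
  refine ⟨?_, h.1⟩
  apply Complex.ext
  · simp
  · simp only [RCLike.re_to_complex, Complex.ofReal_im]
    linarith [h.2]

end

/-! ### Partial transposition -/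

section

variable {n : ℕ}

/-- The permutation of the coordinates of `(x, y)` that exchanges `x i` and `y i` for `i ∈ S`. -/
def swapOn (S : Finset (Fin n)) : Fin n ⊕ Fin n → Fin n ⊕ Fin n :=
  Sum.elim (fun i => if i ∈ S then Sum.inr i else Sum.inl i)
    (fun i => if i ∈ S then Sum.inl i else Sum.inr i)

theorem swapOn_involutive (S : Finset (Fin n)) : Function.Involutive (swapOn S) := by
  rintro (i | i) <;> by_cases h : i ∈ S <;> simp [swapOn, h]

theorem partialTranspose_eq (S : Finset (Fin n)) (κ : (Fin n → ℝ) → (Fin n → ℝ) → ℂ)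
    (x y : Fin n → ℝ) : partialTranspose S κ x y =
      κ (fun i => Sum.elim x y (swapOn S (Sum.inl i)))
        (fun i => Sum.elim x y (swapOn S (Sum.inr i))) := by
  have h1 : ∀ i, Sum.elim x y (swapOn S (Sum.inl i)) = if i ∈ S then y i else x i := fun i => by
    by_cases h : i ∈ S <;> simp [swapOn, h]
  have h2 : ∀ i, Sum.elim x y (swapOn S (Sum.inr i)) = if i ∈ S then x i else y i := fun i => by
    by_cases h : i ∈ S <;> simp [swapOn, h]
  simp only [h1, h2]
  rfl

theorem partialTranspose_diagonal (S : Finset (Fin n)) (κ : (Fin n → ℝ) → (Fin n → ℝ) → ℂ)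
    (x : Fin n → ℝ) : partialTranspose S κ x x = κ x x := by
  simp [partialTranspose]

/-- Partial transposition preserves square integrability, as it permutes the coordinates. -/
theorem memLp_partialTranspose (S : Finset (Fin n)) {κ : (Fin n → ℝ) → (Fin n → ℝ) → ℂ}
    (hκ : MemLp (fun z : (Fin n → ℝ) × (Fin n → ℝ) => κ z.1 z.2) 2 volume) :
    MemLp (fun z : (Fin n → ℝ) × (Fin n → ℝ) => partialTranspose S κ z.1 z.2) 2 volume := by
  have h1 := volume_measurePreserving_sumPiEquivProdPi fun _ : Fin n ⊕ Fin n => ℝ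
  have h2 := volume_measurePreserving_piCongrLeft (fun _ : Fin n ⊕ Fin n => ℝ)
    (swapOn_involutive S).toPerm
  have h3 := (h1.comp h2).comp (volume_measurePreserving_sumPiEquivProdPi_symm
    fun _ : Fin n ⊕ Fin n => ℝ)
  refine (hκ.comp_measurePreserving h3).ae_eq (ae_of_all _ fun z => ?_)
  have h4 : ∀ (u : Fin n ⊕ Fin n → ℝ) j, MeasurableEquiv.piCongrLeft (fun _ => ℝ)
      (swapOn_involutive S).toPerm u j = u (swapOn S j) := fun u j => by
    have := Equiv.piCongrLeft_apply_apply (fun _ : Fin n ⊕ Fin n => ℝ)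
      (swapOn_involutive S).toPerm u (swapOn S j)
    rwa [Function.Involutive.coe_toPerm, swapOn_involutive S j] at this
  simp only [Function.comp_apply, partialTranspose_eq]
  congr 1
  · ext i
    exact h4 _ (Sum.inl i)
  · ext i
    exact h4 _ (Sum.inr i)

/-- The partial transpose of a polynomial is the polynomial with permuted variables. -/
theorem polyVal_partialTranspose (S : Finset (Fin n)) (P : MvPolynomial (Fin n ⊕ Fin n) ℂ)
    (x y : Fin n → ℝ) :
    partialTranspose S (polyVal P) x y = polyVal (MvPolynomial.rename (swapOn S) P) x y := by
  rw [partialTranspose_eq, polyVal, polyVal, MvPolynomial.eval_rename]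
  congr 2
  ext (i | i) <;> by_cases h : i ∈ S <;> simp [swapOn, h]

/-- The diagonal sign matrix with entries `-1` on `S`. -/
def signMatrix (S : Finset (Fin n)) : Matrix (Fin n) (Fin n) ℝ :=
  Matrix.diagonal fun i => if i ∈ S then -1 else 1

theorem signMatrix_mulVec_dotProduct (S : Finset (Fin n)) (v w : Fin n → ℝ) :
    (signMatrix S *ᵥ v) ⬝ᵥ w = v ⬝ᵥ (signMatrix S *ᵥ w) := by
  simp only [signMatrix, dotProduct, Matrix.mulVec_diagonal]
  exact Finset.sum_congr rfl fun i _ => by ring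

/-- The partial transpose of a Gaussian kernel is again a Gaussian kernel: partial transposition
keeps `x + y` and changes the sign of the coordinates of `x - y` in `S`. -/
theorem gaussianKernel_partialTranspose (S : Finset (Fin n)) (A B C : Matrix (Fin n) (Fin n) ℝ)
    (x y : Fin n → ℝ) :
    partialTranspose S (gaussianKernel A B C) x y =
      gaussianKernel (signMatrix S * A * signMatrix S) (signMatrix S * B) C x y := by
  have hd : ((fun i => if i ∈ S then y i else x i) - fun i => if i ∈ S then x i else y i) =
      signMatrix S *ᵥ (x - y) := by
    ext i
    by_cases h : i ∈ S <;> simp [signMatrix, Matrix.mulVec_diagonal, h]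
  have hs : ((fun i => if i ∈ S then y i else x i) + fun i => if i ∈ S then x i else y i) =
      x + y := by
    ext i
    by_cases h : i ∈ S <;> simp [h, add_comm]
  simp only [partialTranspose, gaussianKernel, hd, hs, signMatrix_mulVec_dotProduct,
    Matrix.mulVec_mulVec, Matrix.mul_assoc]

theorem isSymm_signMatrix_mul (S : Finset (Fin n)) {A : Matrix (Fin n) (Fin n) ℝ}
    (hA : A.IsSymm) : (signMatrix S * A * signMatrix S).IsSymm := by
  have h : (signMatrix S)ᵀ = signMatrix S := Matrix.diagonal_transpose _
  rw [Matrix.IsSymm, Matrix.transpose_mul, Matrix.transpose_mul, h, hA.eq, Matrix.mul_assoc]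

theorem signMatrix_mul_nonneg (S : Finset (Fin n)) {A : Matrix (Fin n) (Fin n) ℝ}
    (hA : ∀ x, 0 ≤ x ⬝ᵥ A *ᵥ x) (x : Fin n → ℝ) :
    0 ≤ x ⬝ᵥ (signMatrix S * A * signMatrix S) *ᵥ x := by
  have h := hA (signMatrix S *ᵥ x)
  rwa [signMatrix_mulVec_dotProduct, Matrix.mulVec_mulVec, Matrix.mulVec_mulVec] at h

theorem IsIntegralOperator.const_mul {κ : (Fin n → ℝ) → (Fin n → ℝ) → ℂ} {T : L2 n →L[ℂ] L2 n}
    (hT : IsIntegralOperator κ T) (c : ℂ) :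
    IsIntegralOperator (fun x y => c * κ x y) (c • T) := by
  refine ⟨hT.1.const_mul c, fun f => ?_⟩
  filter_upwards [hT.2 f, Lp.coeFn_smul c (T f)] with x h1 h2
  simp_rw [mul_assoc]
  rw [integral_const_mul, ← h1]
  exact h2

theorem IsIntegralOperator.eq_zero {κ : (Fin n → ℝ) → (Fin n → ℝ) → ℂ} {T : L2 n →L[ℂ] L2 n}
    (hT : IsIntegralOperator κ T) (hκ : ∀ x y, κ x y = 0) : T = 0 := by
  ext1 f
  refine Lp.ext ?_
  filter_upwards [hT.2 f, Lp.coeFn_zero ℂ 2 (volume : Measure (Fin n → ℝ))] with x h1 h2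
  rw [h1, zero_apply, h2]
  simp [hκ]

theorem HasTrace.ne_zero {T : L2 n →L[ℂ] L2 n} {t : ℝ} (h : HasTrace T t) (ht : t ≠ 0) :
    T ≠ 0 := by
  rintro rfl
  obtain ⟨ι, b, l, hl, hs⟩ := h
  have h0 : l = 0 := by
    funext i
    have h1 := hl i
    rw [zero_apply, eq_comm, smul_eq_zero] at h1
    exact_mod_cast h1.resolve_right (b.orthonormal.ne_zero i)
  rw [h0] at hs
  exact ht (hs.unique hasSum_zero)

/-- If the partial transpose of a multiple of a polynomial times a Gaussian density kernel is a
density kernel, then so is the partial transpose of the Gaussian density kernel. -/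
theorem isDensityKernel_partialTranspose (S : Finset (Fin n))
    {ρG ρPG : (Fin n → ℝ) → (Fin n → ℝ) → ℂ} (hG : IsGaussianDensityKernel ρG)
    {P : MvPolynomial (Fin n ⊕ Fin n) ℂ} {c : ℂ}
    (hc : ∀ x y, ρPG x y = c * (polyVal P x y * ρG x y))
    (hPT : IsDensityKernel (partialTranspose S ρPG)) :
    IsDensityKernel (partialTranspose S ρG) := by
  obtain ⟨⟨c₀, A, B, C, hc₀, hA, hC, hρ⟩, TG, hTG, hTGpos, hTGtr⟩ := hG
  obtain ⟨T, hT, hTpos, hTtr⟩ := hPT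
  have hc₀' : (c₀ : ℂ) ≠ 0 := by exact_mod_cast hc₀.ne'
  have hnn : ∀ {M : Matrix (Fin n) (Fin n) ℝ}, M.PosDef → ∀ x, 0 ≤ x ⬝ᵥ M *ᵥ x := fun hM x => by
    simpa using hM.posSemidef.dotProduct_mulVec_nonneg x
  have hsymm : ∀ {M : Matrix (Fin n) (Fin n) ℝ}, M.PosDef → M.IsSymm := fun hM =>
    Matrix.isHermitian_iff_isSymm.1 hM.isHermitian
  set A' := signMatrix S * A * signMatrix S with hA'
  set B' := signMatrix S * B with hB'
  -- The transposed polynomial Gaussian kernel is again a polynomial times a Gaussian.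
  set p := MvPolynomial.C (c * c₀) * MvPolynomial.rename (swapOn S) P with hp
  have hker : ∀ x y, partialTranspose S ρPG x y = polyVal p x y * gaussianKernel A' B' C x y := by
    intro x y
    rw [← gaussianKernel_partialTranspose]
    have h1 : polyVal p x y = c * c₀ * partialTranspose S (polyVal P) x y := by
      rw [polyVal_partialTranspose, hp, polyVal, polyVal, map_mul, MvPolynomial.eval_C]
    rw [h1]
    simp only [partialTranspose, hc, hρ]
    ring
  have hp0 : p ≠ 0 := by
    intro h0
    refine hTtr.ne_zero one_ne_zero (hT.eq_zero fun x y => ?_)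
    rw [hker, h0, polyVal, map_zero, zero_mul]
  have hT' : IsIntegralOperator (fun x y => polyVal p x y * gaussianKernel A' B' C x y) T := by
    convert hT using 1
    funext x y
    exact (hker x y).symm
  have hLp : MemLp (fun z : (Fin n → ℝ) × (Fin n → ℝ) => gaussianKernel A' B' C z.1 z.2) 2
      volume := by
    have h1 : MemLp (fun z : (Fin n → ℝ) × (Fin n → ℝ) => gaussianKernel A B C z.1 z.2) 2
        volume := by
      refine (hTG.1.const_mul (c₀ : ℂ)⁻¹).ae_eq (ae_of_all _ fun z => ?_)
      simp only [hρ, inv_mul_cancel_left₀ hc₀']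
    simpa only [gaussianKernel_partialTranspose] using memLp_partialTranspose S h1
  obtain ⟨G, hGop⟩ := exists_isIntegralOperator hLp
  have hGpos : G.IsPositive := isPositive_of_isPositive_polynomial_mul
    (isSymm_signMatrix_mul S (hsymm hA)) (hsymm hC) (signMatrix_mul_nonneg S (hnn hA)) (hnn hC)
    hp0 hT' hTpos hGop
  have hkerG : partialTranspose S ρG = fun x y => (c₀ : ℂ) * gaussianKernel A' B' C x y := by
    funext x y
    rw [← gaussianKernel_partialTranspose]
    simp only [partialTranspose, hρ]
  have hcont : Continuous fun z : (Fin n → ℝ) × (Fin n → ℝ) => ρG z.1 z.2 := by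
    simp only [hρ]
    exact continuous_const.mul (continuous_gaussianKernel A B C)
  have hcont' : Continuous fun z : (Fin n → ℝ) × (Fin n → ℝ) => partialTranspose S ρG z.1 z.2 := by
    simp only [hkerG]
    exact continuous_const.mul (continuous_gaussianKernel A' B' C)
  have hop : IsIntegralOperator (partialTranspose S ρG) ((c₀ : ℂ) • G) := by
    rw [hkerG]
    exact hGop.const_mul _
  have hpos : ((c₀ : ℂ) • G).IsPositive :=
    hGpos.smul_of_nonneg (by exact_mod_cast hc₀.le)
  refine ⟨_, hop, hpos, hasTrace_of_lintegral_diagonal_eq hop hcont' hpos zero_le_one ?_⟩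
  simp only [partialTranspose_diagonal]
  exact lintegral_diagonal_eq hTG hcont hTGpos hTGtr

end

end PolynomialGaussian

/-- If a Gaussian density operator is NPT with respect to a bipartition of the degrees of freedom,
then so is every polynomial Gaussian density operator with the same Gaussian part. -/
theorem corollary2p16 {n : ℕ} (S : Finset (Fin n))
    (ρG : (Fin n → ℝ) → (Fin n → ℝ) → ℂ) (hG : IsGaussianDensityKernel ρG)
    (P : MvPolynomial (Fin n ⊕ Fin n) ℂ) (hP : IsSelfAdjointPolynomial P)
    (ρPG : (Fin n → ℝ) → (Fin n → ℝ) → ℂ)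
    (hPG : IsPolynomialGaussianDensityKernel P ρG ρPG)
    (hNPT : IsNPT S ρG) :
    IsNPT S ρPG := by
  obtain ⟨-, ⟨c, hc⟩, hdens⟩ := hPG
  exact ⟨hdens, fun hPPT => hNPT.2 ⟨hG.2, isDensityKernel_partialTranspose S hG hc hPPT.2⟩⟩
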